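/- Write $\lg=\log_2$. We work in the external memory (I/O) model: the disk holds a bit string divided into consecutive blocks of $B$ words of $w$ bits each, the internal memory consists of $O(B)$ words, one I/O transfers one disk block to internal memory, and only I/Os are counted. Let $q\ge 1$, $q=O(\lg N)$, $w=\Theta(\lg N)$, $B=\Omega(\lg N)$ and $B\le N$. Then there is a data structure which stores any rooted binary tree $T$ (left and right children being distinguished) on $N$ nodes, each carrying a $q$-bit key, in $(3+q)N+o(N)$ bits on disk, such that every root-to-node path of length $K$ (a path from the root to a node at depth $K$) can be reported with 1. $O\!\left(1+\dfrac{K}{\lg(1+(B\lg N)/q)}\right)$ I/Os, when $K=O(\lg N)$; 2. $O\!\left(\dfrac{\lg N}{\lg\left(1+\frac{B\lg^2N}{qK}\right)}\right)$ I/Os, when $K=\Omega(\lg N)$ and $K=O\!\left(\dfrac{B\lg^2N}{q}\right)$; 3. $O\!\left(\dfrac{qK}{B\lg N}\right)$ I/Os, when $K=\Omega\!\left(\dfrac{B\lg^2N}{q}\right)$. Here a path is reported by outputting the keys of its nodes one by one, from the root downwards; after each output the query tells whether to stop, to go to the left child or to go to the right child (a decision that may depend on all the keys output so far), and the path ends when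 the query stops it or asks for a child that does not exist. The data structure (the encoding and the query program) depends only on $N,q,B,w$ and on the constants in the assumptions on $q$, $w$ and $B$; the query program does not depend on $T$; the $o(N)$ term depends only on $N$ and these constants; the same data structure serves all path lengths $K$, and the constants in the I/O bounds depend only on the constants in the assumptions on $q$, $w$, $B$ and in the respective condition on $K$. -/

import Mathlib

open Filter Asymptotics

/-- Binary logarithm. -/
noncomputable def lg (x : ℝ) : ℝ := Real.logb 2 x

/-! ### Root-to-node paths in a binary tree with `q`-bit keys

Binary trees are `BinaryTree (BitVec q)`: `nil` is the empty tree and `node k l r` is a node with key `k`,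
left subtree `l` and right subtree `r`. -/

/-- A top-down query: given the keys of the nodes on the path so far (root first), it says whether
to end the path at the last of them (`none`) or to go on to its left child (`some false`) or to its
right child (`some true`).  The direction may depend on the keys seen (as in a search by key
comparison) or only on their number (as when the end node is given by its position in the tree). -/
abbrev Navigator (q : ℕ) : Type := List (BitVec q) → Option Bool

/-- The keys, from top to bottom, of the nodes on the downward path which `nav` follows in the given
subtree, where `h` is the list of the keys above it.  The path ends where `nav` ends it, or where
the child that `nav` asks for does not exist. -/
def Navigator.pathFrom {q : ℕ} (nav : Navigator q) :
    List (BitVec q) → BinaryTree (BitVec q) → List (BitVec q)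
  | _, .nil => []
  | h, .node k l r =>
      k :: match nav (h ++ [k]) with
        | none => []
        | some false => nav.pathFrom (h ++ [k]) l
        | some true => nav.pathFrom (h ++ [k]) r

/-- The keys on the path that `nav` follows from the root of `T`, root first.  A path of length `K`
(to a node at depth `K`) has `K + 1` keys. -/
def Navigator.path {q : ℕ} (nav : Navigator q) (T : BinaryTree (BitVec q)) : List (BitVec q) :=
  nav.pathFrom [] T

/-! ### The external memory model -/

/-- The `i`-th disk block of `b` bits, when the bit string `D` is stored on disk in consecutive
blocks; positions beyond the end of `D` hold zeros. -/
def diskBlock (b : ℕ) (D : List Bool) (i : ℕ) : Fin b → Bool :=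
  fun j => D.getD (i * b + j) false

/-- What a program does next, as determined by its `m` bits of internal memory:
* `read i next`: one I/O, which transfers the disk block number `i` (of `b` bits) to the processor;
  the new content of the internal memory is computed from the old content and the block;
* `report k next`: output the key `k` as that of the next node on the path, and learn from the query
  how to go on from this node;
* `halt`: stop. -/
inductive MemoryAction (q b m : ℕ) : Type where
  | read (i : ℕ) (next : (Fin b → Bool) → (Fin m → Bool)) : MemoryAction q b m
  | report (k : BitVec q) (next : Option Bool → (Fin m → Bool)) : MemoryAction q b m
  | halt : MemoryAction q b m

/-- An external memory program with disk blocks of `b` bits and an internal memory of `m` bits: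
everything it remembers is in the internal memory.  Only I/Os are counted, computation in internal
memory is free. -/
structure DiskProgram (q b m : ℕ) where
  init : Fin m → Bool
  act : (Fin m → Bool) → MemoryAction q b m

/-- `P.Run D nav s h t out`: on the disk content `D` and the query `nav`, started with the
internal memory `s` when the keys `h` have already been reported, the program `P` halts after
performing exactly `t` further I/Os, and `out` is the list of all keys reported, in order. -/
inductive DiskProgram.Run {q b m : ℕ} (P : DiskProgram q b m) (D : List Bool) (nav : Navigator q) :
    (Fin m → Bool) → List (BitVec q) → ℕ → List (BitVec q) → Prop where
  | halt {s : Fin m → Bool} {h : List (BitVec q)} (hs : P.act s = .halt) : P.Run D nav s h 0 h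
  | read {s : Fin m → Bool} {h out : List (BitVec q)} {t i : ℕ}
      {next : (Fin b → Bool) → (Fin m → Bool)} (hs : P.act s = .read i next)
      (hr : P.Run D nav (next (diskBlock b D i)) h t out) : P.Run D nav s h (t + 1) out
  | report {s : Fin m → Bool} {h out : List (BitVec q)} {t : ℕ} {k : BitVec q}
      {next : Option Bool → (Fin m → Bool)} (hs : P.act s = .report k next)
      (hr : P.Run D nav (next (nav (h ++ [k]))) (h ++ [k]) t out) : P.Run D nav s h t out

/-- A static data structure for binary trees with `q`-bit keys: how a tree is stored as a bit string
on disk, and the (tree-independent) query program. -/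
structure TreeStorage (q b m : ℕ) where
  encode : BinaryTree (BitVec q) → List Bool
  program : DiskProgram q b m

/-- With the encoding of `T` on disk, the path followed by `nav` is reported, and this takes
exactly `t` I/Os. -/
def TreeStorage.ReportsPath {q b m : ℕ} (S : TreeStorage q b m) (T : BinaryTree (BitVec q))
    (nav : Navigator q) (t : ℕ) : Prop :=
  S.program.Run (S.encode T) nav S.program.init [] t (nav.path T)

/-- The assumptions on the number `N` of nodes, the key size `q` (in bits), the block size `B` (in
words) and the word size `w` (in bits), with explicit constants:
`q ≥ 1`, `q = O(lg N)`, `w = Θ(lg N)`, `B = Ω(lg N)` and `B ≤ N`. -/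
structure Admissible (cq cw cw' cB : ℝ) (N q B w : ℕ) : Prop where
  one_le_key : 1 ≤ q
  key_le : (q : ℝ) ≤ cq * lg N
  le_word : cw * lg N ≤ (w : ℝ)
  word_le : (w : ℝ) ≤ cw' * lg N
  le_block : cB * lg N ≤ (B : ℝ)
  block_le : B ≤ N

/-!
A tree is cut into blocks, such that a block starting at a node `v` contains every node reached from
`v` in fewer than `d₀ ≈ lg A` steps and, moreover, the nodes obtained by spending a budget of `A`
nodes: every node costs one unit, and what is left is divided between its children in proportion
to the sizes of their subtrees. Here `A` is of order `B lg N / q`, so that a block fits into a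
constant number of disk blocks and everything reduces to counting the block boundaries on a path.

* Every block is left at depth at least `d₀` only, hence a path of length `K` crosses at most
  `(K + 1) / d₀` boundaries (`crossings_mul_le`). This is the bound for short paths.
* If a block started at a subtree of size `s` is left after `δ` steps towards a subtree of size
  `s'`, the budget left there is below one; as it is at least `A * s' / s - δ`, the size has dropped
  by the factor `A / (2 * δ)`. The product of these factors is at most `N` and the sum of the numbers
  `δ` at most `K`. Bounding `log δ` by its tangent at a point `D` turns this into
  `c * (log (A / (2 * D)) + 1) ≤ log N + (K + 1) / D` for the number `c` of boundaries
  (`crossings_mul_log_le`); taking `D` of order `K / lg N` gives the bound for paths of medium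
  length, and `D = A / 2` the one for long paths.

The space is `(q + 3) * N` bits, without a lower order term. In a block, a node is described by its
key and a token for the kinds of its two children; as at most half of the nodes are leaves, this
takes `q + 5 / 2` bits per node, apart from the subtrees that are cut off. Subtrees of fewer than
`20` nodes are never cut off, so these exceptions are cheap. The subtrees cut off from a block that
have fewer than `A` nodes are stored in groups of roughly `A` nodes, with one pointer for each
group, while a block started at a subtree of size at least `A` has at least `(A - 1) / 2` nodes
(`budget_le_nodes`). As a pointer has `O(lg N)` bits and `A` is a large multiple of this, the
remaining half bit per node pays for all pointers and exceptions (`block_space`).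

The query program reads one pointer and one block for each boundary. A block is decoded from the
prefix-freeness of its encoding (`encAll_append_inj`), and the states of the program are kept in the
internal memory by means of an arbitrary injection, which exists for reasons of cardinality
(`State.exists_code`).
-/

namespace PathBlocking

/-! ### The decomposition of a tree into blocks -/

/-- The budget passed to the subtree `c` by a node with budget `b` and children `c`, `c'`: what is
left after paying for the node itself is divided in proportion to the sizes of the subtrees. -/
noncomputable def budget {q : ℕ} (b : ℝ) (c c' : BinaryTree (BitVec q)) : ℝ :=
  (b - 1) * c.numNodes / (c.numNodes + c'.numNodes)

/-- Whether the root of a subtree of size `s`, reached with `d` free levels and budget `b`, belongs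
to the same block as its parent.  Besides the free levels and the paid nodes, a block takes in
every subtree of fewer than `20` nodes, so that few edges leave the block. -/
def Kept (d : ℕ) (b : ℝ) (s : ℕ) : Prop := s < 20 ∨ 0 < d ∨ 1 ≤ b

open Classical in
/-- The number of block boundaries crossed by the path that `nav` follows in a subtree reached with
`d` free levels and budget `b`.  Every block starts with `d₀` free levels and budget `A`. -/
noncomputable def crossings {q : ℕ} (d₀ A : ℕ) (nav : Navigator q) :
    List (BitVec q) → ℕ → ℝ → BinaryTree (BitVec q) → ℕ
  | _, _, _, .nil => 0
  | h, d, b, .node k l r =>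
      if Kept d b (l.numNodes + r.numNodes + 1) then
        match nav (h ++ [k]) with
        | none => 0
        | some false => crossings d₀ A nav (h ++ [k]) (d - 1) (budget b l r) l
        | some true => crossings d₀ A nav (h ++ [k]) (d - 1) (budget b r l) r
      else
        1 + match nav (h ++ [k]) with
        | none => 0
        | some false => crossings d₀ A nav (h ++ [k]) (d₀ - 1) (budget A l r) l
        | some true => crossings d₀ A nav (h ++ [k]) (d₀ - 1) (budget A r l) r

theorem crossings_of_not_kept {q d₀ A : ℕ} (hd₀ : 0 < d₀) (nav : Navigator q)
    (h : List (BitVec q)) {d : ℕ} {b : ℝ} {T : BinaryTree (BitVec q)}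
    (hT : ¬ Kept d b T.numNodes) :
    crossings d₀ A nav h d b T = 1 + crossings d₀ A nav h d₀ A T := by
  cases T with
  | nil => simp [Kept] at hT
  | node k l r =>
    have h1 : Kept d₀ A (l.numNodes + r.numNodes + 1) := Or.inr (Or.inl hd₀)
    simp only [BinaryTree.numNodes] at hT
    simp only [crossings, if_neg hT, if_pos h1]

/-- A block reaches at least `d₀` levels down. -/
theorem crossings_mul_le {q d₀ A : ℕ} (hd₀ : 0 < d₀) (nav : Navigator q)
    (T : BinaryTree (BitVec q)) : ∀ (h : List (BitVec q)) (d : ℕ) (b : ℝ), d ≤ d₀ →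
      crossings d₀ A nav h d b T * d₀ + d ≤ (nav.pathFrom h T).length + d₀ := by
  induction T with
  | nil => intro h d b hd; simpa [crossings, Navigator.pathFrom] using hd
  | node k l r ihl ihr =>
    have kept : ∀ (h : List (BitVec q)) (d : ℕ) (b : ℝ), d ≤ d₀ →
        Kept d b (l.numNodes + r.numNodes + 1) →
        crossings d₀ A nav h d b (.node k l r) * d₀ + d
          ≤ (nav.pathFrom h (.node k l r)).length + d₀ := by
      intro h d b hd hk
      simp only [crossings, if_pos hk, Navigator.pathFrom, List.length_cons]
      rcases nav (h ++ [k]) with _ | _ | _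
      · simp; omega
      · have := ihl (h ++ [k]) (d - 1) (budget b l r) (by omega)
        simp only; omega
      · have := ihr (h ++ [k]) (d - 1) (budget b r l) (by omega)
        simp only; omega
    intro h d b hd
    by_cases hk : Kept d b (l.numNodes + r.numNodes + 1)
    · exact kept h d b hd hk
    · have hd0 : d = 0 := by
        by_contra hne
        exact hk (Or.inr (Or.inl (Nat.pos_of_ne_zero hne)))
      have := kept h d₀ A le_rfl (Or.inr (Or.inl hd₀))
      rw [crossings_of_not_kept hd₀ nav h (by simpa using hk), hd0, add_mul]
      omega

/-- Along a path in a block, the budget at a node is at least its fair share of the initial budget,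
with `x` units per node of its subtree, less the number of steps made: each step costs at most one
unit. -/
theorem budget_lower {q : ℕ} {b x : ℝ} {c c' : BinaryTree (BitVec q)} {δ : ℕ} (hx : 0 ≤ x)
    (h : x * (c.numNodes + c'.numNodes + 1) - δ ≤ b) :
    x * c.numNodes - (δ + 1 : ℕ) ≤ budget b c c' := by
  unfold budget
  rcases Nat.eq_zero_or_pos c.numNodes with h0 | h0
  · have hδ : (0 : ℝ) ≤ δ := by positivity
    simp [h0]
    linarith
  have hc : (1 : ℝ) ≤ c.numNodes := by exact_mod_cast h0
  have hc' : (0 : ℝ) ≤ c'.numNodes := by positivity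
  rw [le_div_iff₀ (by linarith)]
  push_cast
  have hδ : (0 : ℝ) ≤ δ := by positivity
  generalize (c.numNodes : ℝ) = s at *
  generalize (c'.numNodes : ℝ) = s' at *
  generalize (δ : ℝ) = e at *
  have h1 : (x * (s + s' + 1) - e - 1) * s ≤ (b - 1) * s :=
    mul_le_mul_of_nonneg_right (by linarith) (by linarith)
  nlinarith [mul_nonneg hδ hc', mul_nonneg hx (by linarith : (0 : ℝ) ≤ s)]

/-- A path crosses few block boundaries, because leaving a block after `δ` steps shrinks the
subtree below at least by the factor `A / (δ + 1)`.  Here `S` is the size of the subtree in which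
the current block was started and `δ` the number of steps made in this block; the logarithm of
`δ` is bounded by its tangent at `D`. -/
theorem crossings_mul_log_le {q d₀ A : ℕ} (hd₀ : 0 < d₀) (hA : 0 < A) (nav : Navigator q) {D : ℝ}
    (hD : 0 < D) (T : BinaryTree (BitVec q)) :
    ∀ (h : List (BitVec q)) (d : ℕ) (b : ℝ) (S δ : ℕ), 0 < S → d₀ ≤ d + δ →
      A * T.numNodes / S - (δ : ℝ) ≤ b →
      crossings d₀ A nav h d b T * (Real.log (A / (2 * D)) + 1)
        ≤ Real.log S + (δ + (nav.pathFrom h T).length) / D := by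
  have nonneg : ∀ S δ n : ℕ, 0 < S → 0 ≤ Real.log S + ((δ : ℝ) + n) / D := by
    intro S δ n hS
    have : (0 : ℝ) ≤ Real.log S := Real.log_nonneg (by exact_mod_cast hS)
    positivity
  induction T with
  | nil =>
    intro h d b S δ hS _ _
    simpa [crossings] using nonneg S δ (nav.pathFrom h BinaryTree.nil).length hS
  | node k l r ihl ihr =>
    have kept : ∀ (h : List (BitVec q)) (d : ℕ) (b : ℝ) (S δ : ℕ), 0 < S → d₀ ≤ d + δ →
        A * (BinaryTree.node k l r).numNodes / S - (δ : ℝ) ≤ b →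
        Kept d b (l.numNodes + r.numNodes + 1) →
        crossings d₀ A nav h d b (.node k l r) * (Real.log (A / (2 * D)) + 1)
          ≤ Real.log S + (δ + (nav.pathFrom h (.node k l r)).length) / D := by
      intro h d b S δ hS hdδ hb hk
      have hSR : (0 : ℝ) < S := by exact_mod_cast hS
      have hx : (0 : ℝ) ≤ (A : ℝ) / S := by positivity
      have hN : ((BinaryTree.node k l r).numNodes : ℝ) = l.numNodes + r.numNodes + 1 := by
        simp
      rw [hN, mul_div_right_comm] at hb
      simp only [crossings, if_pos hk, Navigator.pathFrom, List.length_cons]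
      rcases nav (h ++ [k]) with _ | _ | _
      · simpa using nonneg S δ 1 hS
      · have := ihl (h ++ [k]) (d - 1) (budget b l r) S (δ + 1) hS (by omega)
          (by rw [mul_div_right_comm]; exact budget_lower hx hb)
        push_cast at this ⊢
        convert this using 3
        ring
      · have := ihr (h ++ [k]) (d - 1) (budget b r l) S (δ + 1) hS (by omega)
          (by
            rw [mul_div_right_comm]
            exact budget_lower hx (by rw [add_comm (r.numNodes : ℝ)]; exact hb))
        push_cast at this ⊢
        convert this using 3
        ring
    intro h d b S δ hS hdδ hb
    by_cases hk : Kept d b (l.numNodes + r.numNodes + 1)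
    · exact kept h d b S δ hS hdδ hb hk
    · set s := (BinaryTree.node k l r).numNodes with hs
      have hs0 : 0 < s := by simp [hs]
      have hsR : (0 : ℝ) < s := by exact_mod_cast hs0
      have hSR : (0 : ℝ) < S := by exact_mod_cast hS
      have hAR : (0 : ℝ) < A := by exact_mod_cast hA
      have h1 := kept h d₀ A s 0 hs0 (by omega)
        (by field_simp; simp) (Or.inr (Or.inl hd₀))
      rw [crossings_of_not_kept hd₀ nav h (by simpa using hk)]
      simp only [Kept, not_or, not_lt, not_le] at hk
      obtain ⟨-, hd, hb1⟩ := hk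
      have hδ : (1 : ℝ) ≤ δ := by exact_mod_cast (show 1 ≤ δ by omega)
      have h2 : A * (s : ℝ) / S ≤ 2 * δ := by linarith
      -- the subtree shrinks by the factor `A / (2 * δ)`
      have h3 : Real.log A + Real.log s - Real.log S ≤ Real.log 2 + Real.log δ := by
        rw [← Real.log_mul (by positivity) (by positivity),
          ← Real.log_div (by positivity) (by positivity),
          ← Real.log_mul (by positivity) (by positivity)]
        exact Real.log_le_log (by positivity) h2
      have h4 : Real.log δ - Real.log D ≤ δ / D - 1 := by
        rw [← Real.log_div (by positivity) (by positivity)]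
        exact Real.log_le_sub_one_of_pos (by positivity)
      have h5 : Real.log (A / (2 * D)) = Real.log A - (Real.log 2 + Real.log D) := by
        rw [Real.log_div (by positivity) (by positivity),
          Real.log_mul (by positivity) (by positivity)]
      push_cast at h1 ⊢
      rw [add_mul, one_mul, add_div]
      rw [zero_add] at h1
      linarith

/-! ### Pieces and their encoding -/

/-- The part of a tree stored in one block.  `nil` is an empty subtree of the tree, `cross new` a
subtree stored elsewhere: with the next pointer of the block if `new` holds, otherwise with the same
pointer as the preceding such subtree. -/
inductive Piece (q : ℕ) : Type where
  | nil : Piece q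
  | cross (new : Bool) : Piece q
  | node (k : BitVec q) (l r : Piece q) : Piece q

namespace Piece

variable {q : ℕ}

/-- Number of nodes. -/
def nodes : Piece q → ℕ
  | nil => 0
  | cross _ => 0
  | node _ l r => l.nodes + r.nodes + 1

/-- The marks of the subtrees that are cut off, from left to right. -/
def flags : Piece q → List Bool
  | nil => []
  | cross f => [f]
  | node _ l r => l.flags ++ r.flags

/-- The constructor of a piece, in two bits. -/
def kind : Piece q → Bool × Bool
  | nil => (false, false)
  | cross f => (true, f)
  | node _ _ _ => (false, true)

end Piece

/-- A prefix code for the kinds of the two children of a node, cheap unless one of them is cut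
off. -/
def token : Bool × Bool → Bool × Bool → List Bool
  | (false, true), (false, true) => [true, true]
  | (false, true), (false, false) => [true, false]
  | (false, false), (false, true) => [false, true]
  | (false, false), (false, false) => [false, false, false]
  | (a, b), (c, d) => [false, false, true, a, b, c, d]

/-- The decoder for `token`. -/
def untoken : List Bool → ((Bool × Bool) × (Bool × Bool)) × List Bool
  | true :: true :: x => (((false, true), (false, true)), x)
  | true :: false :: x => (((false, true), (false, false)), x)
  | false :: true :: x => (((false, false), (false, true)), x)
  | false :: false :: false :: x => (((false, false), (false, false)), x)
  | false :: false :: true :: a :: b :: c :: d :: x => (((a, b), (c, d)), x)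
  | x => (((false, false), (false, false)), x)

theorem untoken_token (u v : Bool × Bool) (x : List Bool) :
    untoken (token u v ++ x) = ((u, v), x) := by
  obtain ⟨a, b⟩ := u
  obtain ⟨c, d⟩ := v
  cases a <;> cases b <;> cases c <;> cases d <;> rfl

/-- The bits of a bit vector as a list. -/
def bitList {n : ℕ} (k : BitVec n) : List Bool := List.ofFn fun i : Fin n => k.getLsb i

@[simp] theorem length_bitList {n : ℕ} (k : BitVec n) : (bitList k).length = n := by
  simp [bitList]

theorem bitList_injective {n : ℕ} : Function.Injective (bitList (n := n)) := by
  intro k k' h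
  have := List.ofFn_injective h
  ext i hi
  simpa using congrFun this ⟨i, hi⟩

namespace Piece

variable {q : ℕ}

/-- The encoding of a piece: its nodes in preorder, each given by the kinds of its children and its
key.  A piece without nodes is known from its kind. -/
def enc : Piece q → List Bool
  | nil => []
  | cross _ => []
  | node k l r => token l.kind r.kind ++ bitList k ++ l.enc ++ r.enc

theorem enc_append_inj (P : Piece q) : ∀ (P' : Piece q) (x y : List Bool), P.kind = P'.kind →
    P.enc ++ x = P'.enc ++ y → P = P' ∧ x = y := by
  induction P with
  | nil => intro P' x y hk h; cases P' <;> simp_all [kind, enc]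
  | cross f => intro P' x y hk h; cases P' <;> simp_all [kind, enc]
  | node k l r ihl ihr =>
    intro P' x y hk h
    cases P' with
    | nil => simp [kind] at hk
    | cross f => simp [kind] at hk
    | node k' l' r' =>
      simp only [enc, List.append_assoc] at h
      have h1 := congrArg untoken h
      rw [untoken_token, untoken_token] at h1
      simp only [Prod.mk.injEq] at h1
      obtain ⟨⟨hl, hr⟩, h2⟩ := h1
      obtain ⟨hkey, h3⟩ := List.append_inj h2 (by simp)
      obtain ⟨rfl, h4⟩ := ihl _ _ _ hl h3
      obtain ⟨rfl, h5⟩ := ihr _ _ _ hr h4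
      exact ⟨by rw [bitList_injective hkey], h5⟩

/-- A piece with at least one node. -/
def IsNode : Piece q → Prop
  | node _ _ _ => True
  | _ => False

theorem IsNode.kind_eq {P : Piece q} (h : P.IsNode) : P.kind = (false, true) := by
  cases P <;> simp_all [IsNode, kind]

theorem isNode_iff_nodes_pos {P : Piece q} : P.IsNode ↔ 0 < P.nodes := by
  cases P <;> simp [IsNode, nodes]

theorem length_flags_le (P : Piece q) : P.flags.length ≤ P.nodes + 1 := by
  induction P with
  | nil => simp [flags]
  | cross f => simp [flags]
  | node k l r ihl ihr => simp only [flags, nodes, List.length_append]; omega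

theorem le_length_enc (P : Piece q) : 2 * P.nodes ≤ P.enc.length := by
  induction P with
  | nil => simp [nodes]
  | cross f => simp [nodes]
  | node k l r ihl ihr =>
    have : 2 ≤ (token l.kind r.kind).length := by
      rcases l.kind with ⟨_ | _, _ | _⟩ <;> rcases r.kind with ⟨_ | _, _ | _⟩ <;> simp [token]
    simp only [enc, nodes, List.length_append]
    omega

theorem length_enc_le (P : Piece q) : P.enc.length ≤ (q + 7) * P.nodes := by
  induction P with
  | nil => simp [enc]
  | cross f => simp [enc]
  | node k l r ihl ihr =>
    have : (token l.kind r.kind).length ≤ 7 := by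
      rcases l.kind with ⟨_ | _, _ | _⟩ <;> rcases r.kind with ⟨_ | _, _ | _⟩ <;> simp [token]
    simp only [enc, nodes, List.length_append, length_bitList, mul_add]
    omega

/-- At most half of the nodes of a binary tree are leaves, hence a piece takes hardly more than two
and a half bits per node besides the keys, unless many subtrees are cut off. -/
theorem two_mul_length_enc_le (P : Piece q) :
    2 * P.enc.length ≤ (2 * q + 5) * P.nodes + 1 + 9 * P.flags.length := by
  induction P with
  | nil => simp [enc]
  | cross f => simp [enc]
  | node k l r ihl ihr =>
    cases l <;> cases r <;>
      simp only [enc, nodes, flags, kind, token, List.length_append, length_bitList, List.length_cons,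
        List.length_nil, mul_add, add_mul] at ihl ihr ⊢ <;> omega

end Piece

/-- The concatenated encodings of the pieces of a block. -/
def encAll {q : ℕ} (F : List (Piece q)) : List Bool := F.flatMap Piece.enc

theorem encAll_append_inj {q : ℕ} (F : List (Piece q)) : ∀ (F' : List (Piece q)) (x y : List Bool),
    F.length = F'.length → (∀ P ∈ F, P.IsNode) → (∀ P ∈ F', P.IsNode) →
    encAll F ++ x = encAll F' ++ y → F = F' ∧ x = y := by
  induction F with
  | nil =>
    intro F' x y hl _ _ h
    obtain rfl : F' = [] := List.length_eq_zero_iff.1 hl.symm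
    exact ⟨rfl, by simpa [encAll] using h⟩
  | cons P F ih =>
    intro F' x y hl hF hF' h
    cases F' with
    | nil => simp at hl
    | cons P' F' =>
      simp only [encAll, List.flatMap_cons, List.append_assoc] at h
      obtain ⟨rfl, h1⟩ := P.enc_append_inj P' _ _
        (by rw [(hF P (by simp)).kind_eq, (hF' P' (by simp)).kind_eq]) h
      obtain ⟨rfl, h2⟩ := ih F' x y (by simpa using hl) (fun Q hQ => hF Q (by simp [hQ]))
        (fun Q hQ => hF' Q (by simp [hQ])) h1
      exact ⟨rfl, h2⟩

/-! ### The piece of a subtree and the subtrees it leaves to other blocks -/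

section Cutting

variable {q : ℕ}

open Classical in
/-- The subtrees, from left to right, which are cut off from a subtree reached with `d` free levels
and budget `b`. -/
noncomputable def hanging : ℕ → ℝ → BinaryTree (BitVec q) → List (BinaryTree (BitVec q))
  | _, _, .nil => []
  | d, b, .node k l r =>
      if Kept d b (l.numNodes + r.numNodes + 1) then
        hanging (d - 1) (budget b l r) l ++ hanging (d - 1) (budget b r l) r
      else [.node k l r]

/-- Whether a hanging subtree `u` starts a new group, if the last group has `st` nodes so far.
A group is closed when it has at least `A` nodes, and subtrees of size at least `A` form a group by
themselves. -/
def startsGroup (A st : ℕ) (u : BinaryTree (BitVec q)) : Bool :=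
  decide (A ≤ st ∨ A ≤ u.numNodes)

/-- The number of nodes in the last group after `u` has been added. -/
def groupSize (A st : ℕ) (u : BinaryTree (BitVec q)) : ℕ :=
  if startsGroup A st u then u.numNodes else st + u.numNodes

open Classical in
/-- The part of a subtree that is stored in the block of the parent. -/
noncomputable def piece (A : ℕ) : ℕ → ℝ → ℕ → BinaryTree (BitVec q) → Piece q
  | _, _, _, .nil => .nil
  | d, b, st, .node k l r =>
      if Kept d b (l.numNodes + r.numNodes + 1) then
        .node k (piece A (d - 1) (budget b l r) st l)
          (piece A (d - 1) (budget b r l)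
            ((hanging (d - 1) (budget b l r) l).foldl (groupSize A) st) r)
      else .cross (startsGroup A st (.node k l r))

/-- The marks of a list of hanging subtrees. -/
def groupFlags (A : ℕ) : ℕ → List (BinaryTree (BitVec q)) → List Bool
  | _, [] => []
  | st, u :: us => startsGroup A st u :: groupFlags A (groupSize A st u) us

theorem groupFlags_append (A : ℕ) (us vs : List (BinaryTree (BitVec q))) : ∀ st : ℕ,
    groupFlags A st (us ++ vs) = groupFlags A st us ++ groupFlags A (us.foldl (groupSize A) st) vs := by
  induction us with
  | nil => intro st; rfl
  | cons u us ih => intro st; simp [groupFlags, ih]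

theorem length_groupFlags (A : ℕ) (us : List (BinaryTree (BitVec q))) : ∀ st : ℕ,
    (groupFlags A st us).length = us.length := by
  induction us with
  | nil => intro st; rfl
  | cons u us ih => intro st; simp [groupFlags, ih]

theorem flags_piece (A : ℕ) (T : BinaryTree (BitVec q)) : ∀ (d : ℕ) (b : ℝ) (st : ℕ),
    (piece A d b st T).flags = groupFlags A st (hanging d b T) := by
  induction T with
  | nil => intro d b st; rfl
  | node k l r ihl ihr =>
    intro d b st
    by_cases hk : Kept d b (l.numNodes + r.numNodes + 1)
    · simp only [piece, hanging, if_pos hk, Piece.flags, groupFlags_append, ihl, ihr]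
    · simp only [piece, hanging, if_neg hk, Piece.flags, groupFlags]

theorem piece_isNode {A d : ℕ} {b : ℝ} {st : ℕ} {T : BinaryTree (BitVec q)} (hT : T ≠ .nil)
    (hk : Kept d b T.numNodes) : (piece A d b st T).IsNode := by
  cases T with
  | nil => exact absurd rfl hT
  | node k l r =>
    simp only [BinaryTree.numNodes] at hk
    simp [piece, if_pos hk, Piece.IsNode]

/-- Every node is in the piece or in a hanging subtree. -/
theorem nodes_piece_add (A : ℕ) (T : BinaryTree (BitVec q)) : ∀ (d : ℕ) (b : ℝ) (st : ℕ),
    (piece A d b st T).nodes + ((hanging d b T).map BinaryTree.numNodes).sum = T.numNodes := by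
  induction T with
  | nil => intro d b st; rfl
  | node k l r ihl ihr =>
    intro d b st
    by_cases hk : Kept d b (l.numNodes + r.numNodes + 1)
    · simp only [piece, hanging, if_pos hk, Piece.nodes, BinaryTree.numNodes, List.map_append,
        List.sum_append]
      rw [← ihl (d - 1) (budget b l r) st, ← ihr (d - 1) (budget b r l)
        ((hanging (d - 1) (budget b l r) l).foldl (groupSize A) st)]
      ring
    · simp [piece, hanging, if_neg hk, Piece.nodes]

theorem le_numNodes_of_mem_hanging (T : BinaryTree (BitVec q)) : ∀ (d : ℕ) (b : ℝ),
    ∀ u ∈ hanging d b T, 20 ≤ u.numNodes := by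
  induction T with
  | nil => intro d b u hu; simp [hanging] at hu
  | node k l r ihl ihr =>
    intro d b u hu
    by_cases hk : Kept d b (l.numNodes + r.numNodes + 1)
    · simp only [hanging, if_pos hk, List.mem_append] at hu
      exact hu.elim (ihl _ _ u) (ihr _ _ u)
    · simp only [hanging, if_neg hk, List.mem_singleton] at hu
      subst hu
      simp only [Kept, not_or, not_lt] at hk
      simpa using hk.1

theorem budget_add {b : ℝ} {l r : BinaryTree (BitVec q)} (h : 0 < l.numNodes + r.numNodes) :
    budget b l r + budget b r l = b - 1 := by
  have : (0 : ℝ) < l.numNodes + r.numNodes := by exact_mod_cast h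
  unfold budget
  rw [add_comm (r.numNodes : ℝ)]
  field_simp

theorem budget_le_numNodes {b : ℝ} {l r : BinaryTree (BitVec q)}
    (h : b ≤ (l.numNodes + r.numNodes + 1 : ℕ)) : budget b l r ≤ l.numNodes := by
  unfold budget
  push_cast at h
  rcases Nat.eq_zero_or_pos l.numNodes with h0 | h0
  · simp [h0]
  have h1 : (1 : ℝ) ≤ l.numNodes := by exact_mod_cast h0
  have h2 : (0 : ℝ) ≤ r.numNodes := by positivity
  rw [div_le_iff₀ (by linarith)]
  nlinarith

theorem numNodes_le_budget {b : ℝ} {l r : BinaryTree (BitVec q)}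
    (h : ((l.numNodes + r.numNodes + 1 : ℕ) : ℝ) ≤ b) : l.numNodes ≤ budget b l r := by
  unfold budget
  push_cast at h
  rcases Nat.eq_zero_or_pos l.numNodes with h0 | h0
  · simp [h0]
  have h1 : (1 : ℝ) ≤ l.numNodes := by exact_mod_cast h0
  have h2 : (0 : ℝ) ≤ r.numNodes := by positivity
  rw [le_div_iff₀ (by linarith)]
  nlinarith

/-- A subtree whose budget covers its size is stored in one piece. -/
theorem hanging_eq_nil (T : BinaryTree (BitVec q)) : ∀ (d : ℕ) (b : ℝ), (T.numNodes : ℝ) ≤ b →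
    hanging d b T = [] := by
  induction T with
  | nil => intro d b _; rfl
  | node k l r ihl ihr =>
    intro d b hb
    have hb' : ((l.numNodes + r.numNodes + 1 : ℕ) : ℝ) ≤ b := by simpa using hb
    have hk : Kept d b (l.numNodes + r.numNodes + 1) := by
      refine Or.inr (Or.inr (le_trans ?_ hb'))
      exact_mod_cast Nat.le_add_left _ _
    simp only [hanging, if_pos hk]
    rw [ihl _ _ (numNodes_le_budget hb'),
      ihr _ _ (numNodes_le_budget (by rwa [add_comm r.numNodes]))]
    rfl

/-- At least about half of the budget is spent, since each of the hanging subtrees wastes less than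
one unit of it. -/
theorem budget_le_nodes (A : ℕ) (T : BinaryTree (BitVec q)) : ∀ (d : ℕ) (b : ℝ) (st : ℕ),
    b ≤ T.numNodes → b ≤ 2 * (piece A d b st T).nodes + 1 := by
  induction T with
  | nil => intro d b st hb; simp [piece, Piece.nodes] at *; linarith
  | node k l r ihl ihr =>
    intro d b st hb
    have hb' : b ≤ ((l.numNodes + r.numNodes + 1 : ℕ) : ℝ) := by simpa using hb
    by_cases hk : Kept d b (l.numNodes + r.numNodes + 1)
    · have hl := ihl (d - 1) (budget b l r) st (budget_le_numNodes hb')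
      have hr := ihr (d - 1) (budget b r l)
        ((hanging (d - 1) (budget b l r) l).foldl (groupSize A) st)
        (budget_le_numNodes (by rwa [add_comm r.numNodes]))
      simp only [piece, if_pos hk, Piece.nodes]
      push_cast
      rcases Nat.eq_zero_or_pos (l.numNodes + r.numNodes) with h0 | h0
      · rw [h0] at hb'
        have : b ≤ 1 := by simpa using hb'
        have h3 : ∀ n : ℕ, (0 : ℝ) ≤ n := fun n => by positivity
        linarith [h3 (piece A (d - 1) (budget b l r) st l).nodes,
          h3 (piece A (d - 1) (budget b r l)
            ((hanging (d - 1) (budget b l r) l).foldl (groupSize A) st) r).nodes]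
      · linarith [budget_add (b := b) h0]
    · simp only [piece, if_neg hk, Piece.nodes]
      simp only [Kept, not_or, not_lt, not_le] at hk
      push_cast
      linarith [hk.2.2]

theorem max_budget_add_le {b : ℝ} {l r : BinaryTree (BitVec q)} :
    max (budget b l r) 0 + max (budget b r l) 0 ≤ max (b - 1) 0 := by
  rcases Nat.eq_zero_or_pos (l.numNodes + r.numNodes) with h0 | h0
  · have h1 : l.numNodes = 0 := by omega
    have h2 : r.numNodes = 0 := by omega
    simp [budget, h1, h2]
  · have hadd := budget_add (b := b) h0
    have hl : (0 : ℝ) ≤ l.numNodes := by positivity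
    have hr : (0 : ℝ) ≤ r.numNodes := by positivity
    rcases le_total 0 (b - 1) with hb | hb
    · have h1 : 0 ≤ budget b l r := by unfold budget; positivity
      have h2 : 0 ≤ budget b r l := by unfold budget; positivity
      rw [max_eq_left h1, max_eq_left h2, max_eq_left hb, hadd]
    · have h1 : budget b l r ≤ 0 := by
        unfold budget
        exact div_nonpos_of_nonpos_of_nonneg (mul_nonpos_of_nonpos_of_nonneg hb hl) (by positivity)
      have h2 : budget b r l ≤ 0 := by
        unfold budget
        exact div_nonpos_of_nonpos_of_nonneg (mul_nonpos_of_nonpos_of_nonneg hb hr) (by positivity)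
      simp [h1, h2]

/-- A piece has the nodes of the free levels and the paid nodes, together at most
`2 ^ d - 1 + max b 0`, and fewer than `20` further nodes for each edge leaving these. -/
theorem nodes_piece_le (A : ℕ) (T : BinaryTree (BitVec q)) : ∀ (d : ℕ) (b : ℝ) (st : ℕ),
    ((piece A d b st T).nodes : ℝ) ≤ 20 * (2 * 2 ^ d - 1 + 2 * max b 0) := by
  have pow1 : ∀ d : ℕ, (1 : ℝ) ≤ 2 ^ d := fun d => one_le_pow₀ (by norm_num)
  induction T with
  | nil =>
    intro d b st
    simp only [piece, Piece.nodes, Nat.cast_zero]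
    linarith [pow1 d, le_max_right b 0]
  | node k l r ihl ihr =>
    intro d b st
    by_cases hk : Kept d b (l.numNodes + r.numNodes + 1)
    · rcases Nat.lt_or_ge (l.numNodes + r.numNodes + 1) 20 with hs | hs
      · have h1 : (piece A d b st (.node k l r)).nodes ≤ 20 := by
          have := nodes_piece_add A (.node k l r) d b st
          simp only [BinaryTree.numNodes] at this
          omega
        have h2 : ((piece A d b st (.node k l r)).nodes : ℝ) ≤ 20 := by exact_mod_cast h1
        linarith [pow1 d, le_max_right b 0]
      · have hl := ihl (d - 1) (budget b l r) st
        have hr := ihr (d - 1) (budget b r l)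
          ((hanging (d - 1) (budget b l r) l).foldl (groupSize A) st)
        have hm := max_budget_add_le (b := b) (l := l) (r := r)
        simp only [piece, if_pos hk, Piece.nodes]
        push_cast
        have hmono : max (b - 1) 0 ≤ max b 0 := max_le_max (by linarith) le_rfl
        rcases Nat.eq_zero_or_pos d with hd | hd
        · subst hd
          have hb : 1 ≤ b := by
            rcases hk with h | h | h
            · omega
            · omega
            · exact h
          rw [max_eq_left (by linarith : (0 : ℝ) ≤ b - 1)] at hm
          rw [max_eq_left (by linarith : (0 : ℝ) ≤ b)]
          norm_num at hl hr ⊢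
          linarith
        · obtain ⟨e, rfl⟩ : ∃ e, d = e + 1 := ⟨d - 1, by omega⟩
          simp only [Nat.add_sub_cancel] at hl hr ⊢
          rw [pow_succ]
          linarith
    · simp only [piece, if_neg hk, Piece.nodes, Nat.cast_zero]
      linarith [pow1 d, le_max_right b 0]

end Cutting

/-! ### Groups of hanging subtrees -/

section Groups

variable {q : ℕ}

/-- The hanging subtrees `us` in groups, if the last group opened before them has `st` nodes: the
subtrees that still belong to that group, and the list of the new groups. -/
def groups (A : ℕ) : ℕ → List (BinaryTree (BitVec q)) →
    List (BinaryTree (BitVec q)) × List (List (BinaryTree (BitVec q)))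
  | _, [] => ([], [])
  | st, u :: us =>
      let G := groups A (groupSize A st u) us
      if startsGroup A st u then ([], (u :: G.1) :: G.2) else (u :: G.1, G.2)

/-- The position of a hanging subtree: the number of groups up to its own, and its place in that
group.  The position of the next subtree is determined by its mark. -/
def advance (c : ℕ × ℕ) (f : Bool) : ℕ × ℕ := if f then (c.1 + 1, 0) else (c.1, c.2 + 1)

/-- All the subtrees in a list satisfy `Q` together with their positions, where `c` is the position
of the subtree before them. -/
def Placed (Q : ℕ → ℕ → BinaryTree (BitVec q) → Prop) (A : ℕ) :
    ℕ × ℕ → ℕ → List (BinaryTree (BitVec q)) → Prop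
  | _, _, [] => True
  | c, st, u :: us =>
      Q (advance c (startsGroup A st u)).1 (advance c (startsGroup A st u)).2 u ∧
        Placed Q A (advance c (startsGroup A st u)) (groupSize A st u) us

theorem placed_append {Q : ℕ → ℕ → BinaryTree (BitVec q) → Prop} {A : ℕ}
    (us vs : List (BinaryTree (BitVec q))) : ∀ (c : ℕ × ℕ) (st : ℕ),
    Placed Q A c st (us ++ vs) ↔ Placed Q A c st us ∧
      Placed Q A ((groupFlags A st us).foldl advance c) (us.foldl (groupSize A) st) vs := by
  induction us with
  | nil => intro c st; simp [Placed, groupFlags]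
  | cons u us ih => intro c st; simp [Placed, groupFlags, ih, and_assoc]

theorem placed_of_groups {Q : ℕ → ℕ → BinaryTree (BitVec q) → Prop} {A : ℕ}
    (us : List (BinaryTree (BitVec q))) : ∀ (c : ℕ × ℕ) (st : ℕ),
    (∀ x u, (groups A st us).1[x]? = some u → Q c.1 (c.2 + 1 + x) u) →
    (∀ g F x u, (groups A st us).2[g]? = some F → F[x]? = some u → Q (c.1 + 1 + g) x u) →
    Placed Q A c st us := by
  induction us with
  | nil => intro c st _ _; trivial
  | cons u us ih =>
    intro c st h1 h2
    by_cases hs : startsGroup A st u = true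
    · simp only [groups, hs, if_true] at h1 h2
      refine ⟨?_, ih _ _ ?_ ?_⟩
      · simpa [hs, advance] using h2 0 _ 0 u List.getElem?_cons_zero List.getElem?_cons_zero
      · intro x v hv
        have := h2 0 _ (x + 1) v List.getElem?_cons_zero (by simpa using hv)
        simpa [hs, advance, add_comm] using this
      · intro g F x v hF hv
        have := h2 (g + 1) F x v (by simpa using hF) hv
        simp only [hs, advance, if_true]
        rwa [show c.1 + 1 + 1 + g = c.1 + 1 + (g + 1) by ring]
    · simp only [groups, hs] at h1 h2
      simp only [Bool.false_eq_true, if_false] at h1 h2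
      refine ⟨?_, ih _ _ ?_ ?_⟩
      · simpa [hs, advance] using h1 0 u (by simp)
      · intro x v hv
        have := h1 (x + 1) v (by simpa using hv)
        simp only [hs, advance, Bool.false_eq_true, if_false]
        rwa [show c.2 + 1 + 1 + x = c.2 + 1 + (x + 1) by ring]
      · intro g F x v hF hv
        simpa [hs, advance] using h2 g F x v hF hv

theorem groups_flatten (A : ℕ) (us : List (BinaryTree (BitVec q))) : ∀ st : ℕ,
    (groups A st us).1 ++ (groups A st us).2.flatten = us := by
  induction us with
  | nil => intro st; rfl
  | cons u us ih =>
    intro st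
    have := ih (groupSize A st u)
    simp only [groups]
    split <;> simp [this]

theorem groups_fst_eq_nil {A st : ℕ} (h : A ≤ st) (us : List (BinaryTree (BitVec q))) :
    (groups A st us).1 = [] := by
  cases us with
  | nil => rfl
  | cons u us => simp [groups, startsGroup, h]

/-- What a block consists of: a single nonempty tree of any size, or several nonempty trees of
fewer than `A` nodes each, and fewer than `2 * A` nodes together. -/
def IsGroup (A : ℕ) (F : List (BinaryTree (BitVec q))) : Prop :=
  (∃ u, u ≠ .nil ∧ F = [u]) ∨
    (∀ u ∈ F, u ≠ .nil ∧ u.numNodes < A) ∧ (F.map BinaryTree.numNodes).sum < 2 * A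

theorem groups_isGroup {A : ℕ} (us : List (BinaryTree (BitVec q))) : ∀ st : ℕ,
    (∀ u ∈ us, u ≠ .nil) →
    (st < A → (∀ u ∈ (groups A st us).1, u ≠ .nil ∧ u.numNodes < A) ∧
      st + ((groups A st us).1.map BinaryTree.numNodes).sum < 2 * A) ∧
    ∀ F ∈ (groups A st us).2, IsGroup A F := by
  induction us with
  | nil => intro st _; simp [groups]; omega
  | cons u us ih =>
    intro st hne
    have hu := hne u (by simp)
    obtain ⟨h1, h2⟩ := ih (groupSize A st u) fun v hv => hne v (by simp [hv])
    by_cases hs : startsGroup A st u = true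
    · simp only [groupSize, hs, if_true] at h1 h2
      simp only [groups, groupSize, hs, if_true]
      refine ⟨fun hst => ⟨by simp, by simp; omega⟩, ?_⟩
      intro F hF
      rcases List.mem_cons.1 hF with rfl | hF
      · rcases Nat.lt_or_ge u.numNodes A with hA | hA
        · obtain ⟨h3, h4⟩ := h1 hA
          refine Or.inr ⟨?_, by simpa using h4⟩
          intro v hv
          rcases List.mem_cons.1 hv with rfl | hv
          · exact ⟨hu, hA⟩
          · exact h3 v hv
        · exact Or.inl ⟨u, hu, by rw [groups_fst_eq_nil hA]⟩
      · exact h2 F hF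
    · simp only [groupSize, hs, Bool.false_eq_true, if_false] at h1 h2
      simp only [groups, groupSize, hs, Bool.false_eq_true, if_false]
      refine ⟨fun hst => ?_, h2⟩
      simp only [startsGroup, decide_eq_true_eq, not_or, not_le] at hs
      have hsmall : (groups A (st + u.numNodes) us).1 = [] ∨ st + u.numNodes < A := by
        rcases Nat.lt_or_ge (st + u.numNodes) A with h | h
        · exact Or.inr h
        · exact Or.inl (groups_fst_eq_nil h us)
      rcases hsmall with h | h
      · rw [h]
        refine ⟨by simpa using ⟨hu, hs.2⟩, by simp; omega⟩
      · obtain ⟨h3, h4⟩ := h1 h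
        refine ⟨?_, by simp only [List.map_cons, List.sum_cons]; omega⟩
        intro v hv
        rcases List.mem_cons.1 hv with rfl | hv
        · exact ⟨hu, hs.2⟩
        · exact h3 v hv

/-- A share of the pointers of a block: with `p` bits each, four times their length is at most the
sum of these shares and `4 * p`. -/
def pointerShare (A p : ℕ) (u : BinaryTree (BitVec q)) : ℕ :=
  if A ≤ u.numNodes then 8 * p else u.numNodes

/-- Only groups followed by a large subtree and the last group can have fewer than `A` nodes. -/
theorem length_groups_le {A p : ℕ} (hA : 4 * p ≤ A) (us : List (BinaryTree (BitVec q))) :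
    ∀ st : ℕ, 4 * p * (groups A st us).2.length
      ≤ min (4 * p) st + (us.map (pointerShare A p)).sum := by
  induction us with
  | nil => intro st; simp [groups]
  | cons u us ih =>
    intro st
    have := ih (groupSize A st u)
    by_cases hs : startsGroup A st u = true
    · simp only [groupSize, hs, if_true] at this
      simp only [groups, groupSize, hs, if_true, List.length_cons, List.map_cons, List.sum_cons,
        mul_add, mul_one, pointerShare]
      simp only [startsGroup, decide_eq_true_eq] at hs
      split <;> omega
    · simp only [groupSize, hs, Bool.false_eq_true, if_false] at this
      simp only [groups, groupSize, hs, Bool.false_eq_true, if_false, List.map_cons, List.sum_cons,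
        pointerShare]
      simp only [startsGroup, decide_eq_true_eq, not_or, not_le] at hs
      split <;> omega

/-- Twice the number of bits granted to a subtree in a group, with `p` bits per pointer.  A large
subtree saves the bits for the pointers to it and to the group before it. -/
def allowance (A p : ℕ) (u : BinaryTree (BitVec q)) : ℤ :=
  if A ≤ u.numNodes then (2 * q + 6) * u.numNodes - 4 * p - 12 else (2 * q + 5) * u.numNodes + 1

/-- The space of a block and of everything below it: the piece in the block, the pointers and the
subtrees stored elsewhere fit into the allowance. -/
theorem block_space {A p n : ℕ} (hA : 12 * p + 27 ≤ A) {us : List (BinaryTree (BitVec q))}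
    (hus : ∀ u ∈ us, 20 ≤ u.numNodes) (hn : A ≤ 2 * n + 1) :
    ((2 * q + 5) * n + 1 + 9 * us.length : ℤ) + 2 * (p * (groups A A us).2.length)
        + (us.map (allowance A p)).sum
      ≤ (2 * q + 6) * (n + (us.map BinaryTree.numNodes).sum : ℕ) - 4 * p - 12 := by
  have h1 := length_groups_le (A := A) (p := p) (by omega) us A
  rw [min_eq_left (by omega)] at h1
  -- twice over: a subtree pays for its mark in the parent's piece and for its share of the pointers,
  -- a large one from what its allowance saves, a small one from a bit for each of its 20 or more nodes
  have h2 : ∀ vs : List (BinaryTree (BitVec q)), (∀ u ∈ vs, 20 ≤ u.numNodes) →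
      (18 * vs.length + (vs.map (pointerShare A p)).sum : ℤ) + 2 * (vs.map (allowance A p)).sum
        ≤ 2 * ((2 * q + 6) * ((vs.map BinaryTree.numNodes).sum : ℕ)) := by
    intro vs
    induction vs with
    | nil => intro _; simp
    | cons u vs ih =>
      intro hvs
      have h3 := ih fun v hv => hvs v (by simp [hv])
      have h4 : (20 : ℤ) ≤ u.numNodes := by exact_mod_cast hvs u (by simp)
      have h5 : (18 + pointerShare A p u : ℤ) + 2 * allowance A p u
          ≤ 2 * ((2 * q + 6) * u.numNodes) := by
        unfold pointerShare allowance
        split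
        · push_cast; linarith
        · linarith
      simp only [List.length_cons, List.map_cons, List.sum_cons]
      push_cast at h3 ⊢
      linarith
  have h3 := h2 us hus
  have h4 : (4 * p * (groups A A us).2.length : ℤ)
      ≤ 4 * p + (us.map (pointerShare A p)).sum := by exact_mod_cast h1
  have h5 : (12 * p + 27 : ℤ) ≤ 2 * n + 1 := by exact_mod_cast hA.trans hn
  push_cast at h3 h4 ⊢
  linarith

end Groups

/-! ### Bit strings on disk -/

/-- The `n` bits on disk from position `s` on. -/
def window (D : List Bool) (s n : ℕ) : List Bool :=
  (List.range n).map fun j => D.getD (s + j) false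

@[simp] theorem length_window (D : List Bool) (s n : ℕ) : (window D s n).length = n := by
  simp [window]

theorem window_add (D : List Bool) (s n n' : ℕ) :
    window D s (n + n') = window D s n ++ window D (s + n) n' := by
  simp [window, List.range_add, Function.comp_def, add_assoc]

theorem ofFn_diskBlock (b : ℕ) (D : List Bool) (i : ℕ) :
    List.ofFn (diskBlock b D i) = window D (i * b) b := by
  apply List.ext_getElem <;> simp [window, diskBlock]

theorem drop_window (D : List Bool) (s d n : ℕ) :
    (window D s (d + n)).drop d = window D (s + d) n := by
  rw [window_add, List.drop_left' (length_window _ _ _)]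

/-- The bit string `E` is on disk from position `o` on. -/
def Stored (D : List Bool) (o : ℕ) (E : List Bool) : Prop := window D o E.length = E

theorem stored_zero_self (D : List Bool) : Stored D 0 D := by
  apply List.ext_getElem
  · simp
  · intro i _ h
    simp [window, h]

theorem stored_append {D : List Bool} {o : ℕ} {E E' : List Bool} :
    Stored D o (E ++ E') ↔ Stored D o E ∧ Stored D (o + E.length) E' := by
  unfold Stored
  rw [List.length_append, window_add]
  constructor
  · intro h
    exact List.append_inj h (by simp)
  · rintro ⟨h1, h2⟩
    rw [h1, h2]

theorem Stored.isPrefix_window {D : List Bool} {o n : ℕ} {E : List Bool} (h : Stored D o E)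
    (hn : E.length ≤ n) : E <+: window D o n := by
  obtain ⟨n', rfl⟩ := Nat.exists_eq_add_of_le hn
  rw [window_add, h]
  exact List.prefix_append _ _

/-! ### The query program -/

/-- What the program remembers.
* `pointer c j buf`: it is reading the pointer at position `c`, in order to go on with the `j`-th
  tree of the block to which this points; `buf` has been read so far.
* `record a j buf`: it is reading the block at position `a` for the sake of its `j`-th tree.
* `node e i j k l r`: it is about to report the root of the piece `.node k l r`, which belongs to a
  block with pointers from position `e` on; `(i, j)` is the position (see `advance`) of the last
  hanging subtree to the left of this piece. -/
inductive State (q : ℕ) : Type where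
  | done : State q
  | pointer (c j : ℕ) (buf : List Bool) : State q
  | record (a j : ℕ) (buf : List Bool) : State q
  | node (e i j : ℕ) (k : BitVec q) (l r : Piece q) : State q

namespace State

variable {q : ℕ}

/-- The constructor, the numbers and the bit string of a state. -/
def registers : State q → Fin 4 × ℕ × ℕ × ℕ × List Bool
  | done => (0, 0, 0, 0, [])
  | pointer c j buf => (1, c, j, 0, buf)
  | record a j buf => (2, a, j, 0, buf)
  | node e i j k l r => (3, e, i, j, (Piece.node k l r).enc)

theorem registers_injective : Function.Injective (registers (q := q)) := by
  intro s s' h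
  cases s <;> cases s' <;> simp_all [registers]
  rename_i k l r _ _ _ k' l' r'
  have := (Piece.node k l r).enc_append_inj (.node k' l' r') [] [] rfl (by simpa using h.2.2.2)
  simpa using this.1

/-- States whose numbers have at most `X` bits and whose bit string has at most `X` bits. -/
def Small (X : ℕ) (s : State q) : Prop :=
  s.registers.2.1 < 2 ^ X ∧ s.registers.2.2.1 < 2 ^ X ∧ s.registers.2.2.2.1 < 2 ^ X ∧
    s.registers.2.2.2.2.length ≤ X

/-- Small states fit into the internal memory. -/
theorem exists_code {X m : ℕ} (h : 5 * X + 2 ≤ m) :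
    ∃ (code : State q → (Fin m → Bool)) (decode : (Fin m → Bool) → State q),
      ∀ s, s.Small X → decode (code s) = s := by
  -- the length of the bit string is recorded, since the string itself is padded with zeros
  let ψ : State q → Fin 4 × Fin (2 ^ X) × Fin (2 ^ X) × Fin (2 ^ X) × Fin (2 ^ X) ×
      (Fin X → Bool) := fun s =>
    (s.registers.1, Fin.ofNat _ s.registers.2.1, Fin.ofNat _ s.registers.2.2.1,
      Fin.ofNat _ s.registers.2.2.2.1, Fin.ofNat _ s.registers.2.2.2.2.length,
      fun i => s.registers.2.2.2.2.getD i false)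
  have hψ : Set.InjOn ψ {s | s.Small X} := by
    intro s hs s' hs' heq
    obtain ⟨h1, h2, h3, h4⟩ := hs
    obtain ⟨h1', h2', h3', h4'⟩ := hs'
    apply registers_injective
    have lt {n : ℕ} (hn : n ≤ X) : n < 2 ^ X := hn.trans_lt Nat.lt_two_pow_self
    simp only [ψ, Prod.mk.injEq, Fin.ext_iff, Fin.val_ofNat, Nat.mod_eq_of_lt h1,
      Nat.mod_eq_of_lt h2, Nat.mod_eq_of_lt h3, Nat.mod_eq_of_lt (lt h4), Nat.mod_eq_of_lt h1',
      Nat.mod_eq_of_lt h2', Nat.mod_eq_of_lt h3', Nat.mod_eq_of_lt (lt h4')] at heq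
    obtain ⟨g0, g1, g2, g3, g4, g5⟩ := heq
    have g6 : s.registers.2.2.2.2 = s'.registers.2.2.2.2 := by
      refine List.ext_getElem g4 fun i hi hi' => ?_
      have := congrFun g5 ⟨i, by omega⟩
      simpa [hi, hi'] using this
    exact Prod.ext (Fin.ext g0) (Prod.ext g1 (Prod.ext g2 (Prod.ext g3 g6)))
  obtain ⟨ε⟩ : Nonempty ((Fin 4 × Fin (2 ^ X) × Fin (2 ^ X) × Fin (2 ^ X) × Fin (2 ^ X) ×
      (Fin X → Bool)) ↪ (Fin m → Bool)) := by
    apply Function.Embedding.nonempty_of_card_le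
    simp only [Fintype.card_prod, Fintype.card_fin, Fintype.card_fun, Fintype.card_bool]
    calc 4 * (2 ^ X * (2 ^ X * (2 ^ X * (2 ^ X * 2 ^ X)))) = 2 ^ (5 * X + 2) := by ring
      _ ≤ 2 ^ m := Nat.pow_le_pow_right (by norm_num) h
  have hinj : Set.InjOn (fun s => ε (ψ s)) {s | s.Small X} :=
    fun s hs s' hs' heq => hψ hs hs' (ε.injective heq)
  have : Nonempty (State q) := ⟨.done⟩
  exact ⟨fun s => ε (ψ s), Function.invFunOn (fun s => ε (ψ s)) {s | s.Small X},
    fun s hs => hinj.leftInvOn_invFunOn hs⟩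

end State

section Program

variable {q : ℕ}

/-- `x` describes the first `j + 1` trees of a block whose encoding is a prefix of `buf`: the first
`j` of them and the key and the children of the last one. -/
def IsEntry (buf : List Bool) (j : ℕ)
    (x : List (Piece q) × BitVec q × Piece q × Piece q) : Prop :=
  x.1.length = j ∧ (∀ P ∈ x.1, P.IsNode) ∧
    encAll (x.1 ++ [.node x.2.1 x.2.2.1 x.2.2.2]) <+: buf

theorem IsEntry.unique {buf : List Bool} {j : ℕ}
    {x y : List (Piece q) × BitVec q × Piece q × Piece q} (hx : IsEntry buf j x)
    (hy : IsEntry buf j y) : x = y := by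
  obtain ⟨hx1, hx2, z, hz⟩ := hx
  obtain ⟨hy1, hy2, z', hz'⟩ := hy
  have := encAll_append_inj _ _ z z' (by simp [hx1, hy1])
    (by simpa [or_imp, forall_and, Piece.IsNode] using hx2)
    (by simpa [or_imp, forall_and, Piece.IsNode] using hy2) (hz.trans hz'.symm)
  obtain ⟨h1, h2⟩ := List.append_inj this.1 (by rw [hx1, hy1])
  simp only [List.cons.injEq, Piece.node.injEq, and_true] at h2
  exact Prod.ext h1 (Prod.ext h2.1 (Prod.ext h2.2.1 h2.2.2))

open Classical in
/-- The decoder for a block read into `buf`. -/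
noncomputable def lookup (buf : List Bool) (j : ℕ) :
    Option (List (Piece q) × BitVec q × Piece q × Piece q) :=
  if h : ∃ x, IsEntry buf j x then some h.choose else none

theorem lookup_eq {buf : List Bool} {j : ℕ} {x : List (Piece q) × BitVec q × Piece q × Piece q}
    (h : IsEntry buf j x) : lookup buf j = some x := by
  have hex : ∃ x : List (Piece q) × BitVec q × Piece q × Piece q, IsEntry buf j x := ⟨x, h⟩
  rw [lookup, dif_pos hex, hex.choose_spec.unique h]

/-- The state in which the program goes on with a piece of the current block, when `c` is the
position of the last hanging subtree to the left of it. -/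
def goTo (p e : ℕ) (c : ℕ × ℕ) : Piece q → State q
  | .nil => .done
  | .cross f => .pointer (e + p * ((advance c f).1 - 1)) (advance c f).2 []
  | .node k l r => .node e c.1 c.2 k l r

/-- The state after the query has said how to go on from a node with children `l` and `r`. -/
def follow (p e : ℕ) (c : ℕ × ℕ) (l r : Piece q) : Option Bool → State q
  | none => .done
  | some false => goTo p e c l
  | some true => goTo p e (l.flags.foldl advance c) r

/-- The number with the `p`-bit binary representation `x`. -/
noncomputable def pointerValue (p : ℕ) (x : List Bool) : ℕ :=
  (Function.invFun (bitList (n := p)) x).toNat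

theorem pointerValue_bitList {p a : ℕ} (ha : a < 2 ^ p) :
    pointerValue p (bitList (BitVec.ofNat p a)) = a := by
  rw [pointerValue, Function.leftInverse_invFun bitList_injective]
  simpa using Nat.mod_eq_of_lt ha

/-- The action in the state `.record a j buf`: the block at position `a` is taken from the `R` disk
blocks following this position. -/
noncomputable def recordAction {b m : ℕ} (R p : ℕ) (code : State q → (Fin m → Bool)) (a j : ℕ)
    (buf : List Bool) : MemoryAction q b m :=
  if buf.length < R * b then
    .read (a / b + buf.length / b) fun x => code (.record a j (buf ++ List.ofFn x))
  else match lookup (buf.drop (a % b)) j with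
    | none => .halt
    | some (F, k, l, r) =>
        .report k fun ans => code (follow p (a + (encAll (F ++ [.node k l r])).length) (0, 0) l r ans)

/-- What the program does in a given state. -/
noncomputable def action {b m : ℕ} (R p : ℕ) (code : State q → (Fin m → Bool)) :
    State q → MemoryAction q b m
  | .done => .halt
  | .pointer c j buf =>
      if buf.length < R * b then
        .read (c / b + buf.length / b) fun x => code (.pointer c j (buf ++ List.ofFn x))
      else recordAction R p code (pointerValue p ((buf.drop (c % b)).take p)) j []
  | .record a j buf => recordAction R p code a j buf
  | .node e i j k l r => .report k fun ans => code (follow p e (i, j) l r ans)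

end Program

/-- The parameters of the data structure: the depth `d₀` to which a block reaches at least, the
budget `A` of a block, the number `p` of bits of a pointer, the number `R` of consecutive disk
blocks read to fetch a pointer or a block, and the representation of states in the internal
memory. -/
structure Machine (q b m : ℕ) where
  d₀ : ℕ
  A : ℕ
  p : ℕ
  R : ℕ
  code : State q → (Fin m → Bool)
  decode : (Fin m → Bool) → State q
  d₀_pos : 0 < d₀
  pow_le : 2 ^ d₀ ≤ A
  le_A : 12 * p + 27 ≤ A
  b_pos : 0 < b
  pointer_fits : p + b ≤ R * b
  block_fits : 80 * A * (q + 7) + b ≤ R * b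
  decode_code : ∀ s : State q, s.Small (R * b) → decode (code s) = s

namespace Machine

variable {q b m : ℕ} (M : Machine q b m)

/-- The query program; the block of the root of the tree is at the beginning of the disk. -/
noncomputable def program : DiskProgram q b m where
  init := M.code (.record 0 0 [])
  act x := action M.R M.p M.code (M.decode x)

theorem act_code {s : State q} (hs : s.Small (M.R * b)) :
    M.program.act (M.code s) = action M.R M.p M.code s := by
  simp only [program, M.decode_code s hs]

theorem p_le : M.p ≤ M.R * b := le_trans (Nat.le_add_right _ _) M.pointer_fits

theorem lt_two_pow {n : ℕ} (h : n < 2 ^ M.p) : n < 2 ^ (M.R * b) :=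
  h.trans_le (Nat.pow_le_pow_right (by norm_num) M.p_le)

theorem R_mul_pos : 0 < M.R * b := lt_of_lt_of_le M.b_pos (le_trans (by omega) M.pointer_fits)

/-- A run depends on the state only through the first action. -/
theorem run_of_act_eq {P : DiskProgram q b m} {D : List Bool} {nav : Navigator q}
    {s s' : Fin m → Bool} {h out : List (BitVec q)} {t : ℕ} (hs : P.act s' = P.act s)
    (hr : P.Run D nav s h t out) : P.Run D nav s' h t out := by
  cases hr with
  | halt h1 => exact .halt (hs.trans h1)
  | read h1 h2 => exact .read (hs.trans h1) h2
  | report h1 h2 => exact .report (hs.trans h1) h2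

/-- Reading `R` consecutive disk blocks. -/
theorem run_fetch {D : List Bool} {nav : Navigator q} {h out : List (BitVec q)} {t s₀ : ℕ}
    {F : List Bool → State q}
    (hF : ∀ buf, buf.length ≤ M.R * b → (F buf).Small (M.R * b))
    (hact : ∀ buf, buf.length < M.R * b → action (b := b) M.R M.p M.code (F buf) =
      .read (s₀ + buf.length / b) fun x => M.code (F (buf ++ List.ofFn x)))
    (hr : M.program.Run D nav (M.code (F (window D (s₀ * b) (M.R * b)))) h t out) :
    M.program.Run D nav (M.code (F [])) h (t + M.R) out := by
  have key : ∀ n ≤ M.R, M.program.Run D nav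
      (M.code (F (window D (s₀ * b) ((M.R - n) * b)))) h (t + n) out := by
    intro n
    induction n with
    | zero => intro _; simpa using hr
    | succ n ih =>
      intro hn
      obtain ⟨c, hc⟩ : ∃ c, M.R = c + (n + 1) := ⟨M.R - (n + 1), by omega⟩
      have hlt : (window D (s₀ * b) (c * b)).length < M.R * b := by
        rw [length_window]
        exact Nat.mul_lt_mul_of_pos_right (by omega) M.b_pos
      have h1 := ih (by omega)
      rw [show M.R - n = c + 1 by omega, add_mul, one_mul, window_add, ← add_mul,
        ← ofFn_diskBlock] at h1
      rw [show M.R - (n + 1) = c by omega]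
      refine DiskProgram.Run.read (i := s₀ + c)
        (next := fun x => M.code (F (window D (s₀ * b) (c * b) ++ List.ofFn x))) ?_ h1
      rw [M.act_code (hF _ hlt.le), hact _ hlt, length_window, Nat.mul_div_cancel _ M.b_pos]
  simpa [window] using key M.R le_rfl

/-- With `D` on disk, the program reports the paths in `u` when it starts to fetch the block at
position `a` for the sake of its `j`-th tree. -/
def Ready (D : List Bool) (a j : ℕ) (u : BinaryTree (BitVec q)) : Prop :=
  ∀ (nav : Navigator q) (h : List (BitVec q)), ∃ t : ℕ,
    M.program.Run D nav (M.code (.record a j [])) h t (h ++ nav.pathFrom h u) ∧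
      t ≤ M.R + 2 * M.R * crossings M.d₀ M.A nav h M.d₀ M.A u

/-- The same when it starts to fetch the pointer at position `c`. -/
def PointerReady (D : List Bool) (c j : ℕ) (u : BinaryTree (BitVec q)) : Prop :=
  ∀ (nav : Navigator q) (h : List (BitVec q)), ∃ t : ℕ,
    M.program.Run D nav (M.code (.pointer c j [])) h t (h ++ nav.pathFrom h u) ∧
      t ≤ 2 * M.R * (1 + crossings M.d₀ M.A nav h M.d₀ M.A u)

/-- It suffices that the pointer is on disk and leads to a place where `u` is ready. -/
theorem pointerReady {D : List Bool} {c j a : ℕ} {u : BinaryTree (BitVec q)} (hc : c < 2 ^ M.p)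
    (hj : j ≤ M.R * b) (ha : a < 2 ^ M.p) (hD : Stored D c (bitList (BitVec.ofNat M.p a)))
    (hu : M.Ready D a j u) : M.PointerReady D c j u := by
  intro nav h
  obtain ⟨t, hrun, ht⟩ := hu nav h
  have hj' : j < 2 ^ (M.R * b) := lt_of_le_of_lt hj Nat.lt_two_pow_self
  have hsmall : ∀ buf : List Bool, buf.length ≤ M.R * b →
      (State.pointer (q := q) c j buf).Small (M.R * b) := fun buf hbuf =>
    ⟨M.lt_two_pow hc, hj', by simp [State.registers], hbuf⟩
  refine ⟨t + M.R, M.run_fetch (F := .pointer c j) (s₀ := c / b) hsmall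
    (fun buf hbuf => by simp only [action, if_pos hbuf]) (run_of_act_eq ?_ hrun), by
      linarith⟩
  have hval : ((window D (c / b * b) (M.R * b)).drop (c % b)).take M.p
      = bitList (BitVec.ofNat M.p a) := by
    have hmod : c % b < b := Nat.mod_lt _ M.b_pos
    have hfit := M.pointer_fits
    obtain ⟨n, hn⟩ : ∃ n, M.R * b = c % b + (M.p + n) := ⟨M.R * b - c % b - M.p, by omega⟩
    rw [hn, drop_window, Nat.div_add_mod', window_add, List.take_left' (length_window _ _ _)]
    simpa [Stored] using hD
  rw [M.act_code (hsmall _ (by simp)),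
    M.act_code (s := .record a j []) ⟨M.lt_two_pow ha, hj', by simp [State.registers],
      by simp [State.registers]⟩]
  simp only [action, length_window, lt_irrefl, if_false]
  rw [hval, pointerValue_bitList ha]

/-- Navigation in a piece, when the pointers of its block, from position `e` on, are in place: each
block boundary on the path costs the I/Os for one pointer and one block. -/
theorem run_goTo {D : List Bool} {nav : Navigator q} {e : ℕ} (he : e < 2 ^ M.p)
    (T : BinaryTree (BitVec q)) : ∀ (h : List (BitVec q)) (d : ℕ) (y : ℝ) (st : ℕ) (c : ℕ × ℕ),
    Placed (fun i j u => M.PointerReady D (e + M.p * (i - 1)) j u) M.A c st (hanging d y T) →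
    c.1 + (piece M.A d y st T).flags.length ≤ M.R * b →
    c.2 + (piece M.A d y st T).flags.length ≤ M.R * b →
    (piece M.A d y st T).enc.length ≤ M.R * b →
    ∃ t, M.program.Run D nav (M.code (goTo M.p e c (piece M.A d y st T))) h t
        (h ++ nav.pathFrom h T) ∧
      t ≤ 2 * M.R * crossings M.d₀ M.A nav h d y T := by
  have hdone : ∀ h : List (BitVec q), M.program.Run D nav (M.code .done) h 0 h := fun h =>
    .halt (by
      rw [M.act_code (by simp [State.Small, State.registers])]
      rfl)
  have hadv : ∀ (fs : List Bool) (c : ℕ × ℕ), (fs.foldl advance c).1 ≤ c.1 + fs.length ∧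
      (fs.foldl advance c).2 ≤ c.2 + fs.length := by
    intro fs
    induction fs with
    | nil => intro c; simp
    | cons f fs ih =>
      intro c
      have h1 := ih (advance c f)
      have h2 : (advance c f).1 ≤ c.1 + 1 ∧ (advance c f).2 ≤ c.2 + 1 := by
        cases f <;> simp [advance]
      simp only [List.foldl_cons, List.length_cons]
      omega
  induction T with
  | nil =>
    intro h d y st c _ _ _ _
    exact ⟨0, by simpa [piece, goTo, Navigator.pathFrom] using hdone h, Nat.zero_le _⟩
  | node k l r ihl ihr =>
    intro h d y st c hpl h1 h2 h3
    by_cases hk : Kept d y (l.numNodes + r.numNodes + 1)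
    · simp only [hanging, if_pos hk, placed_append] at hpl
      simp only [piece, if_pos hk] at h1 h2 h3 ⊢
      simp only [Piece.flags, List.length_append] at h1 h2
      have hlen : ∀ n, n ≤ M.R * b → n < 2 ^ (M.R * b) := fun n hn =>
        lt_of_le_of_lt hn Nat.lt_two_pow_self
      have hact := M.act_code (s := goTo M.p e c (.node k
        (piece M.A (d - 1) (budget y l r) st l) (piece M.A (d - 1) (budget y r l)
            ((hanging (d - 1) (budget y l r) l).foldl (groupSize M.A) st) r)))
        ⟨M.lt_two_pow he, hlen _ (by simp only [goTo, State.registers]; omega),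
          hlen _ (by simp only [goTo, State.registers]; omega),
          by simpa [goTo, State.registers] using h3⟩
      simp only [Piece.enc, List.length_append] at h3
      simp only [goTo, action] at hact
      suffices hs : ∃ t, M.program.Run D nav (M.code (follow M.p e c
            (piece M.A (d - 1) (budget y l r) st l) (piece M.A (d - 1) (budget y r l)
              ((hanging (d - 1) (budget y l r) l).foldl (groupSize M.A) st) r) (nav (h ++ [k]))))
          (h ++ [k]) t (h ++ nav.pathFrom h (.node k l r)) ∧
          t ≤ 2 * M.R * crossings M.d₀ M.A nav h d y (.node k l r) by
        obtain ⟨t, hrun, ht⟩ := hs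
        exact ⟨t, .report hact hrun, ht⟩
      simp only [crossings, if_pos hk, Navigator.pathFrom]
      rcases nav (h ++ [k]) with _ | _ | _
      · exact ⟨0, by simpa [follow] using hdone (h ++ [k]), Nat.zero_le _⟩
      · simpa [follow] using ihl (h ++ [k]) (d - 1) (budget y l r) st c hpl.1 (by omega)
          (by omega) (by omega)
      · have hc := hadv (piece M.A (d - 1) (budget y l r) st l).flags c
        have hpl2 := hpl.2
        rw [← flags_piece] at hpl2
        simpa [follow] using ihr (h ++ [k]) (d - 1) (budget y r l) _ _ hpl2 (by omega)
          (by omega) (by omega)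
    · simp only [hanging, if_neg hk] at hpl
      simp only [piece, if_neg hk, goTo]
      rw [crossings_of_not_kept M.d₀_pos nav h (by simpa using hk)]
      exact hpl.1 nav h

end Machine

/-! ### The layout of a tree on disk -/

section Layout

variable {q : ℕ}

theorem encAll_append (F F' : List (Piece q)) : encAll (F ++ F') = encAll F ++ encAll F' := by
  simp [encAll]

theorem length_le_length_encAll {F : List (Piece q)} (hF : ∀ P ∈ F, P.IsNode) :
    F.length ≤ (encAll F).length := by
  induction F with
  | nil => simp
  | cons P F ih =>
    have h1 := ih fun Q hQ => hF Q (by simp [hQ])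
    have h2 := Piece.isNode_iff_nodes_pos.1 (hF P (by simp))
    have h3 := P.le_length_enc
    simp only [encAll, List.flatMap_cons, List.length_append, List.length_cons] at h1 ⊢
    omega

/-- A sequence of `p`-bit pointers. -/
def pointerTable (p : ℕ) (as : List ℕ) : List Bool := as.flatMap fun a => bitList (BitVec.ofNat p a)

theorem length_pointerTable (p : ℕ) (as : List ℕ) : (pointerTable p as).length = p * as.length := by
  induction as with
  | nil => simp [pointerTable]
  | cons a as ih =>
    simp only [pointerTable, List.flatMap_cons, List.length_append, length_bitList,
      List.length_cons] at ih ⊢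
    rw [ih]
    ring

theorem stored_pointer {D : List Bool} {p : ℕ} (as : List ℕ) : ∀ {e g a : ℕ},
    Stored D e (pointerTable p as) → as[g]? = some a →
    Stored D (e + p * g) (bitList (BitVec.ofNat p a)) := by
  induction as with
  | nil => intro e g a _ h; simp at h
  | cons x as ih =>
    intro e g a hD h
    simp only [pointerTable, List.flatMap_cons] at hD
    obtain ⟨h1, h2⟩ := stored_append.1 hD
    cases g with
    | zero =>
      obtain rfl : x = a := by simpa using h
      simpa using h1
    | succ g =>
      rw [length_bitList] at h2
      have := ih h2 (by simpa using h)
      rwa [show e + p * (g + 1) = e + p + p * g by ring]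

theorem length_le_sum_numNodes {F : List (BinaryTree (BitVec q))} (hF : ∀ u ∈ F, u ≠ .nil) :
    F.length ≤ (F.map BinaryTree.numNodes).sum := by
  induction F with
  | nil => simp
  | cons u F ih =>
    have h1 := ih fun v hv => hF v (by simp [hv])
    have h2 : 0 < u.numNodes := by
      cases u with
      | nil => exact absurd rfl (hF .nil (by simp))
      | node k l r => simp
    simp only [List.length_cons, List.map_cons, List.sum_cons]
    omega

end Layout

namespace Machine

variable {q b m : ℕ} (M : Machine q b m)

/-- The piece of a tree in the block in which it starts. -/
noncomputable def top (u : BinaryTree (BitVec q)) : Piece q := piece M.A M.d₀ M.A M.A u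

/-- The subtrees hanging from the piece of a tree in the block in which it starts. -/
noncomputable def below (u : BinaryTree (BitVec q)) : List (BinaryTree (BitVec q)) :=
  hanging M.d₀ M.A u

theorem top_isNode {u : BinaryTree (BitVec q)} (hu : u ≠ .nil) : (M.top u).IsNode :=
  piece_isNode hu (Or.inr (Or.inl M.d₀_pos))

theorem length_flags_top (u : BinaryTree (BitVec q)) :
    (M.top u).flags.length = (M.below u).length := by
  rw [top, flags_piece, length_groupFlags, below]

theorem nodes_top_add (u : BinaryTree (BitVec q)) :
    (M.top u).nodes + ((M.below u).map BinaryTree.numNodes).sum = u.numNodes :=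
  nodes_piece_add _ _ _ _ _

theorem nodes_top_le (u : BinaryTree (BitVec q)) : (M.top u).nodes ≤ 80 * M.A := by
  have h1 := nodes_piece_le M.A u M.d₀ M.A M.A
  have h2 : (2 : ℝ) ^ M.d₀ ≤ M.A := by exact_mod_cast M.pow_le
  rw [max_eq_left (by positivity)] at h1
  have h3 : ((M.top u).nodes : ℝ) ≤ (80 * M.A : ℕ) := by
    push_cast
    unfold top
    linarith
  exact_mod_cast h3

theorem below_eq_nil {u : BinaryTree (BitVec q)} (h : u.numNodes ≤ M.A) : M.below u = [] :=
  hanging_eq_nil u _ _ (by exact_mod_cast h)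

/-- A tree can be reported if the block in which it starts is on disk and the pointers of this block
are in place. -/
theorem ready_of_stored {D : List Bool} {a j : ℕ} {F : List (BinaryTree (BitVec q))}
    (hF : ∀ u ∈ F, u ≠ .nil) (hD : Stored D a (encAll (F.map M.top)))
    (hfit : (encAll (F.map M.top)).length + b ≤ M.R * b)
    (ha : a + (encAll (F.map M.top)).length < 2 ^ M.p) {u : BinaryTree (BitVec q)}
    (hu : F[j]? = some u)
    (hpl : Placed (fun i j' v => M.PointerReady D
      (a + (encAll ((F.map M.top).take (j + 1))).length + M.p * (i - 1)) j' v) M.A (0, 0) M.A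
      (M.below u)) : M.Ready D a j u := by
  intro nav h
  have hmem : u ∈ F := List.mem_of_getElem? hu
  have hnode := M.top_isNode (hF u hmem)
  have hnodes : ∀ P ∈ F.map M.top, P.IsNode := by
    intro P hP
    obtain ⟨v, hv, rfl⟩ := List.mem_map.1 hP
    exact M.top_isNode (hF v hv)
  have htake : (F.map M.top).take (j + 1) = (F.map M.top).take j ++ [M.top u] := by
    rw [List.take_add_one]
    simp [hu]
  have hsplit : encAll (F.map M.top)
      = encAll ((F.map M.top).take (j + 1)) ++ encAll ((F.map M.top).drop (j + 1)) := by
    rw [← encAll_append, List.take_append_drop]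
  have hjF : j < F.length := by
    by_contra hlt
    rw [List.getElem?_eq_none (by omega)] at hu
    cases hu
  have hlenF := length_le_length_encAll hnodes
  rw [List.length_map] at hlenF
  have hlen := congrArg List.length hsplit
  rw [List.length_append] at hlen
  have hencu : (M.top u).enc.length ≤ (encAll ((F.map M.top).take (j + 1))).length := by
    rw [htake, encAll_append, List.length_append]
    simp [encAll]
  have hfl : (M.top u).flags.length ≤ M.R * b := by
    have h1 := (M.top u).length_flags_le
    have h2 := Piece.isNode_iff_nodes_pos.1 hnode
    have h3 := (M.top u).le_length_enc
    omega
  obtain ⟨t, hrun, ht⟩ := M.run_goTo (nav := nav)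
    (e := a + (encAll ((F.map M.top).take (j + 1))).length) (by omega) u h M.d₀ M.A M.A (0, 0) hpl
    (by rw [zero_add]; exact hfl) (by rw [zero_add]; exact hfl) (show (M.top u).enc.length ≤ _ by omega)
  have hsmall : ∀ buf : List Bool, buf.length ≤ M.R * b →
      (State.record (q := q) a j buf).Small (M.R * b) := fun buf hbuf =>
    ⟨M.lt_two_pow (show a < _ by omega),
      lt_of_le_of_lt (show j ≤ _ by omega) (Nat.lt_two_pow_self (n := M.R * b)), by simp [State.registers], hbuf⟩
  refine ⟨t + M.R, M.run_fetch (F := .record a j) (s₀ := a / b) hsmall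
    (fun buf hbuf => by simp only [action, recordAction, if_pos hbuf]) (run_of_act_eq ?_ hrun), by
      linarith⟩
  change M.program.act _ = M.program.act (M.code (goTo _ _ _ (M.top u)))
  cases htop : M.top u with
  | nil => simp [htop, Piece.IsNode] at hnode
  | cross f => simp [htop, Piece.IsNode] at hnode
  | node k l r =>
    rw [htop] at htake hencu
    have hentry : IsEntry ((window D (a / b * b) (M.R * b)).drop (a % b)) j
        ((F.map M.top).take j, k, l, r) := by
      refine ⟨by simp; omega, fun P hP => hnodes P (List.mem_of_mem_take hP), ?_⟩
      have hmod : a % b < b := Nat.mod_lt _ M.b_pos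
      obtain ⟨n, hn⟩ : ∃ n, M.R * b = a % b + n := ⟨M.R * b - a % b, by omega⟩
      rw [hn, drop_window, Nat.div_add_mod', ← htake]
      rw [hsplit] at hD
      exact (stored_append.1 hD).1.isPrefix_window (by omega)
    rw [M.act_code (hsmall _ (by simp)), M.act_code ⟨M.lt_two_pow (by
      simp only [goTo, State.registers]; omega), by simp [goTo, State.registers],
      by simp [goTo, State.registers], by simp only [goTo, State.registers]; omega⟩]
    simp only [action, recordAction, length_window, lt_irrefl, if_false, lookup_eq hentry, goTo,
      htake]

/-- The claim about the layout of the group `F`: from every position `o` on, it can be stored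
with all that hangs from it. -/
def HasLayout (F : List (BinaryTree (BitVec q))) : Prop :=
  ∀ o : ℕ, ∃ E : List Bool, 2 * (E.length : ℤ) ≤ (F.map (allowance M.A M.p)).sum ∧
    (o + E.length < 2 ^ M.p → ∀ D, Stored D o E → ∀ j u, F[j]? = some u → M.Ready D o j u)

/-- Blocks from which nothing hangs. -/
theorem hasLayout_of_small {F : List (BinaryTree (BitVec q))}
    (hF : ∀ u ∈ F, u ≠ .nil ∧ u.numNodes < M.A)
    (hsum : (F.map BinaryTree.numNodes).sum < 2 * M.A) : M.HasLayout F := by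
  intro o
  have hbelow : ∀ u ∈ F, M.below u = [] := fun u hu => M.below_eq_nil (hF u hu).2.le
  have hspace : ∀ G : List (BinaryTree (BitVec q)), (∀ u ∈ G, u ∈ F) →
      2 * ((encAll (G.map M.top)).length : ℤ) ≤ (G.map (allowance M.A M.p)).sum ∧
      (encAll (G.map M.top)).length ≤ (q + 7) * (G.map BinaryTree.numNodes).sum := by
    intro G
    induction G with
    | nil => intro _; simp [encAll]
    | cons u G ih =>
      intro hG
      obtain ⟨h1, h2⟩ := ih fun v hv => hG v (by simp [hv])
      have huF := hG u (by simp)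
      have h3 := (M.top u).two_mul_length_enc_le
      have h4 := M.nodes_top_add u
      have h5 := (M.top u).length_enc_le
      rw [M.length_flags_top, hbelow u huF] at h3
      simp only [hbelow u huF, List.map_nil, List.sum_nil, add_zero] at h4
      have h6 : allowance M.A M.p u = (2 * q + 5) * u.numNodes + 1 := by
        rw [allowance, if_neg (by have := (hF u huF).2; omega)]
      rw [h4] at h3 h5
      have h7 : (2 * (M.top u).enc.length : ℤ) ≤ (2 * q + 5) * u.numNodes + 1 := by
        exact_mod_cast h3
      simp only [encAll, List.map_cons, List.flatMap_cons, List.length_append, List.sum_cons] at *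
      push_cast
      constructor
      · linarith
      · rw [mul_add]; omega
  obtain ⟨h1, h2⟩ := hspace F fun _ h => h
  refine ⟨encAll (F.map M.top), h1, fun ho D hD j u hu => ?_⟩
  refine M.ready_of_stored (fun v hv => (hF v hv).1) hD ?_ ho hu ?_
  · have h3 : (q + 7) * (F.map BinaryTree.numNodes).sum ≤ (q + 7) * (80 * M.A) :=
      Nat.mul_le_mul_left _ (by omega)
    have h4 := M.block_fits
    rw [show 80 * M.A * (q + 7) = (q + 7) * (80 * M.A) by ring] at h4
    omega
  · rw [hbelow u (List.mem_of_getElem? hu)]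
    trivial

/-- Groups stored one after the other, with their positions `as`. -/
theorem exists_layout_of_groups (G : List (List (BinaryTree (BitVec q)))) :
    (∀ F ∈ G, M.HasLayout F) → ∀ o : ℕ, ∃ (E : List Bool) (as : List ℕ), as.length = G.length ∧
      2 * (E.length : ℤ) ≤ (G.flatten.map (allowance M.A M.p)).sum ∧
      (o + E.length < 2 ^ M.p → (∀ a ∈ as, a < 2 ^ M.p) ∧ ∀ D, Stored D o E →
        ∀ (g : ℕ) F (a : ℕ), G[g]? = some F → as[g]? = some a →
          ∀ j u, F[j]? = some u → M.Ready D a j u) := by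
  induction G with
  | nil => intro _ o; exact ⟨[], [], rfl, by simp, fun _ => ⟨by simp, by simp⟩⟩
  | cons F G ih =>
    intro hG o
    obtain ⟨E₁, hE₁, hR₁⟩ := hG F (by simp) o
    obtain ⟨E₂, as, has, hE₂, hR₂⟩ := ih (fun F' hF' => hG F' (by simp [hF'])) (o + E₁.length)
    refine ⟨E₁ ++ E₂, o :: as, by simp [has], ?_, fun ho => ?_⟩
    · simp only [List.length_append, List.flatten_cons, List.map_append, List.sum_append]
      push_cast
      linarith
    · rw [List.length_append] at ho
      obtain ⟨h1, h2⟩ := hR₂ (by omega)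
      refine ⟨?_, fun D hD g F' a hF' ha j u hu => ?_⟩
      · intro a ha
        rcases List.mem_cons.1 ha with rfl | ha
        · omega
        · exact h1 a ha
      · obtain ⟨hD₁, hD₂⟩ := stored_append.1 hD
        cases g with
        | zero =>
          obtain rfl : F = F' := by simpa using hF'
          obtain rfl : o = a := by simpa using ha
          exact hR₁ (by omega) D hD₁ j u hu
        | succ g => exact h2 D hD₂ g F' a (by simpa using hF') (by simpa using ha) j u hu

/-- A block with its pointers, followed by the groups hanging from it. -/
theorem hasLayout_of_large {u : BinaryTree (BitVec q)} (hu : M.A ≤ u.numNodes)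
    (ih : ∀ F ∈ (groups M.A M.A (M.below u)).2, M.HasLayout F)
    (hgr : ∀ F ∈ (groups M.A M.A (M.below u)).2, IsGroup M.A F) : M.HasLayout [u] := by
  intro o
  set G := (groups M.A M.A (M.below u)).2 with hG
  have hA := M.le_A
  have hflat : G.flatten = M.below u := by
    have := groups_flatten M.A (M.below u) M.A
    rwa [groups_fst_eq_nil le_rfl, List.nil_append] at this
  have hunil : u ≠ .nil := by
    rintro rfl
    simp at hu
    omega
  have hmain : encAll [M.top u] = (M.top u).enc := by simp [encAll]
  obtain ⟨E, as, has, hE, hR⟩ := M.exists_layout_of_groups G ih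
    (o + (M.top u).enc.length + M.p * G.length)
  refine ⟨(M.top u).enc ++ (pointerTable M.p as ++ E), ?_, fun ho D hD j v hv => ?_⟩
  · have h1 := (M.top u).two_mul_length_enc_le
    rw [M.length_flags_top] at h1
    have h2 : M.A ≤ 2 * (M.top u).nodes + 1 := by
      have := budget_le_nodes M.A u M.d₀ M.A M.A (by exact_mod_cast hu)
      exact_mod_cast this
    have h3 := block_space (us := M.below u) hA (le_numNodes_of_mem_hanging u _ _) h2
    rw [M.nodes_top_add, ← hG, ← hflat] at h3
    have h4 : (2 * (M.top u).enc.length : ℤ)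
        ≤ (2 * q + 5) * (M.top u).nodes + 1 + 9 * (M.below u).length := by exact_mod_cast h1
    rw [← hflat] at h4
    simp only [List.length_append, length_pointerTable, has, List.map_cons, List.map_nil,
      List.sum_cons, List.sum_nil, allowance, if_pos hu] at h3 hE ⊢
    push_cast
    linarith
  · simp only [List.length_append, length_pointerTable, has] at ho
    obtain ⟨h1, h2⟩ := hR (by omega)
    obtain ⟨hD₁, hD₂⟩ := stored_append.1 hD
    obtain ⟨hD₂, hD₃⟩ := stored_append.1 hD₂
    rw [length_pointerTable, has] at hD₃
    obtain ⟨rfl, rfl⟩ : j = 0 ∧ u = v := by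
      cases j with
      | zero => exact ⟨rfl, by simpa using hv⟩
      | succ j => simp at hv
    have hfit : (M.top u).enc.length + b ≤ M.R * b := by
      have h3 := (M.top u).length_enc_le
      have h4 := Nat.mul_le_mul_left (q + 7) (M.nodes_top_le u)
      have h5 := M.block_fits
      rw [show 80 * M.A * (q + 7) = (q + 7) * (80 * M.A) by ring] at h5
      omega
    refine M.ready_of_stored (F := [u]) (by simpa using hunil) (by simpa [hmain] using hD₁)
      (by simpa [hmain] using hfit) (by simp only [List.map_cons, List.map_nil, hmain]; omega) hv ?_
    simp only [List.map_cons, List.map_nil, zero_add, List.take_one, List.head?_cons,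
      Option.toList_some, hmain]
    refine placed_of_groups _ _ _ ?_ ?_
    · intro x w hw
      simp [groups_fst_eq_nil] at hw
    · intro g F x w hF hw
      have hg : g < G.length := by
        by_contra hlt
        rw [← hG, List.getElem?_eq_none (by omega)] at hF
        cases hF
      have hx : x < F.length := by
        by_contra hlt
        rw [List.getElem?_eq_none (by omega)] at hw
        cases hw
      have hFlen : F.length ≤ M.R * b := by
        have h3 := M.block_fits
        have h4 : 2 * M.A ≤ 80 * M.A * (q + 7) := by nlinarith
        rcases hgr F (List.mem_of_getElem? hF) with ⟨w, _, rfl⟩ | ⟨h5, h6⟩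
        · simp only [List.length_singleton]
          exact M.R_mul_pos
        · have := length_le_sum_numNodes fun v hv => (h5 v hv).1
          omega
      have hpg : M.p * g ≤ M.p * G.length := Nat.mul_le_mul_left _ hg.le
      have ha : as[g]? = some as[g] := List.getElem?_eq_getElem (by omega)
      have hw' := h2 D hD₃ g F _ hF ha x w hw
      rw [show 0 + 1 + g - 1 = g by omega]
      exact M.pointerReady (by omega) (by omega) (h1 _ (List.getElem_mem _))
        (stored_pointer as hD₂ ha) hw'

/-- Every group has a layout, by induction on its size: the root of a tree belongs to its block, hence
the groups hanging from it are smaller. -/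
theorem hasLayout (n : ℕ) : ∀ F : List (BinaryTree (BitVec q)), IsGroup M.A F →
    (F.map BinaryTree.numNodes).sum ≤ n → M.HasLayout F := by
  have hA := M.le_A
  induction n with
  | zero =>
    intro F hF hn
    rcases hF with ⟨u, hu, rfl⟩ | ⟨h1, h2⟩
    · cases u with
      | nil => exact absurd rfl hu
      | node k l r => simp at hn
    · exact M.hasLayout_of_small h1 h2
  | succ n ih =>
    intro F hF hn
    rcases hF with ⟨u, hu, rfl⟩ | ⟨h1, h2⟩
    · simp only [List.map_cons, List.map_nil, List.sum_cons, List.sum_nil, add_zero] at hn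
      rcases Nat.lt_or_ge u.numNodes M.A with hs | hs
      · exact M.hasLayout_of_small (by simpa using ⟨hu, hs⟩) (by simp; omega)
      · have hgr := (groups_isGroup (A := M.A) (M.below u) M.A (by
          rintro v hv rfl
          have := le_numNodes_of_mem_hanging u _ _ _ hv
          simp at this)).2
        refine M.hasLayout_of_large hs (fun F hF => ih F (hgr F hF) ?_) hgr
        have h3 := M.nodes_top_add u
        have h4 := Piece.isNode_iff_nodes_pos.1 (M.top_isNode hu)
        have h5 : (F.map BinaryTree.numNodes).sum
            ≤ ((M.below u).map BinaryTree.numNodes).sum := by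
          refine List.Sublist.sum_le_sum (List.Sublist.map _ ?_) (by simp)
          rw [← groups_flatten M.A (M.below u) M.A]
          exact (List.sublist_flatten_of_mem hF).trans (List.sublist_append_right _ _)
        omega
    · exact M.hasLayout_of_small h1 h2

/-- A nonempty tree can be stored in `q + 3` bits per node, so that the number of I/Os is determined
by the number of block boundaries on the path. -/
theorem exists_encoding {T : BinaryTree (BitVec q)} (hT : T ≠ .nil)
    (hp : (q + 3) * T.numNodes < 2 ^ M.p) :
    ∃ E : List Bool, E.length ≤ (q + 3) * T.numNodes ∧
      ∀ nav : Navigator q, ∃ t, M.program.Run E nav M.program.init [] t (nav.path T) ∧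
        t ≤ M.R + 2 * M.R * crossings M.d₀ M.A nav [] M.d₀ M.A T := by
  obtain ⟨E, h1, h2⟩ := M.hasLayout T.numNodes [T] (Or.inl ⟨T, hT, rfl⟩) (by simp) 0
  have hpos : (1 : ℤ) ≤ T.numNodes := by
    cases T with
    | nil => exact absurd rfl hT
    | node k l r => exact_mod_cast Nat.le_add_left _ _
  have h3 : E.length ≤ (q + 3) * T.numNodes := by
    simp only [List.map_cons, List.map_nil, List.sum_cons, List.sum_nil, add_zero, allowance] at h1
    zify
    split at h1 <;> linarith
  refine ⟨E, h3, fun nav => ?_⟩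
  obtain ⟨t, hrun, ht⟩ := h2 (by omega) E (stored_zero_self E) 0 T rfl nav []
  exact ⟨t, hrun, ht⟩

end Machine

/-! ### The choice of the parameters -/

section Parameters

variable {cq cw cw' cB : ℝ} {N q B w : ℕ}

theorem lg_le_lg {x y : ℝ} (hx : 0 < x) (h : x ≤ y) : lg x ≤ lg y :=
  Real.logb_le_logb_of_le (by norm_num) hx h

theorem lg_pow_two (n : ℕ) : lg ((2 : ℝ) ^ n) = n := by
  rw [lg, Real.logb_pow, Real.logb_self_eq_one (by norm_num), mul_one]

theorem two_le_of_admissible (h : Admissible cq cw cw' cB N q B w) : 2 ≤ N := by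
  by_contra hN
  have h1 : lg N = 0 := by
    have : N = 0 ∨ N = 1 := by omega
    rcases this with rfl | rfl <;> simp [lg]
  have h2 := h.key_le
  have h3 : (1 : ℝ) ≤ q := by exact_mod_cast h.one_le_key
  rw [h1, mul_zero] at h2
  linarith

theorem one_le_lg (hN : 2 ≤ N) : 1 ≤ lg N := by
  have h2 : ((2 : ℝ) ^ 1) ≤ N := by
    rw [pow_one]
    exact_mod_cast hN
  have h3 := lg_le_lg (by positivity) h2
  rwa [lg_pow_two, Nat.cast_one] at h3

theorem lg_le_self (hN : 2 ≤ N) : lg N ≤ N := by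
  have h1 : (N : ℝ) ≤ 2 ^ N := by exact_mod_cast (Nat.lt_two_pow_self (n := N)).le
  have h2 : (0 : ℝ) < N := by exact_mod_cast (by omega : 0 < N)
  simpa [lg_pow_two] using lg_le_lg h2 h1

/-- Pointers into the data structure have `O(lg N)` bits. -/
theorem size_le (hN : 2 ≤ N) : (Nat.size ((q + 3) * N) : ℝ) ≤ q + 4 + lg N := by
  obtain ⟨s, hs⟩ : ∃ s, Nat.size ((q + 3) * N) = s + 1 :=
    Nat.exists_eq_add_one.2 (Nat.size_pos.2 (by positivity))
  have h1 : 2 ^ s ≤ (q + 3) * N := Nat.lt_size.1 (by omega)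
  have h2 : 2 ^ s ≤ 2 ^ (q + 3) * N :=
    h1.trans (Nat.mul_le_mul_right _ (Nat.lt_two_pow_self (n := q + 3)).le)
  have h3 : (2 : ℝ) ^ s ≤ 2 ^ (q + 3) * N := by exact_mod_cast h2
  have h4 : (0 : ℝ) < N := by exact_mod_cast (by omega : 0 < N)
  have h5 := lg_le_lg (by positivity) h3
  have h6 : lg ((2 : ℝ) ^ (q + 3) * N) = (q + 3 : ℕ) + lg N := by
    rw [← lg_pow_two (q + 3)]
    exact Real.logb_mul (by positivity) (by positivity)
  rw [lg_pow_two, h6] at h5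
  rw [hs]
  push_cast at h5 ⊢
  linarith

theorem params_pos (hcB : 0 < cB) (h : Admissible cq cw cw' cB N q B w) :
    0 < B * lg N / q ∧ 2 ≤ N ∧ 1 ≤ lg N := by
  have hN := two_le_of_admissible h
  have hl := one_le_lg hN
  have hq : (1 : ℝ) ≤ q := by exact_mod_cast h.one_le_key
  have hB : (0 : ℝ) < B := lt_of_lt_of_le (by positivity) h.le_block
  exact ⟨by positivity, hN, hl⟩

/-- With constants `μ` and `R`, and a block budget `A` of order `B lg N / q`, the data structure
exists for all admissible parameters. -/
theorem exists_storage (hcq : 0 < cq) (hcw : 0 < cw) (hcB : 0 < cB) :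
    ∃ μ R : ℕ, ∀ N q B w : ℕ, Admissible cq cw cw' cB N q B w →
      ∃ (S : TreeStorage q (B * w) (μ * B * w)) (A d₀ : ℕ), 0 < d₀ ∧ A < 2 ^ (d₀ + 1) ∧
        1 + B * lg N / q ≤ A ∧ ∀ T : BinaryTree (BitVec q), T.numNodes = N →
          (S.encode T).length ≤ (q + 3) * N ∧ ∀ nav : Navigator q, ∃ t : ℕ,
            S.ReportsPath T nav t ∧ t ≤ R + 2 * R * crossings d₀ A nav [] d₀ A T := by
  set cA : ℝ := (29 + 12 * (cq + 5)) * (cq + 3) / (cB * cw) + 4 / cw with hcA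
  set R : ℕ := ⌈160 * cA⌉₊ + 1 with hR
  refine ⟨5 * R + 2, R, fun N q B w hadm => ?_⟩
  have hN := two_le_of_admissible hadm
  have hl := one_le_lg hN
  set l := lg N
  have hq1 : (1 : ℝ) ≤ q := by exact_mod_cast hadm.one_le_key
  have hq : (q : ℝ) ≤ cq * l := hadm.key_le
  have hw : cw * l ≤ w := hadm.le_word
  have hB : cB * l ≤ B := hadm.le_block
  have hBpos : (0 : ℝ) < B := lt_of_lt_of_le (by positivity) hB
  have hwpos : (0 : ℝ) < w := lt_of_lt_of_le (by positivity) hw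
  have hb : 0 < B * w := by
    have : (0 : ℝ) < (B * w : ℕ) := by push_cast; positivity
    exact_mod_cast this
  set p := Nat.size ((q + 3) * N) with hp
  have hpl : (p : ℝ) ≤ (cq + 5) * l := by
    have := size_le (q := q) hN
    nlinarith
  set x : ℝ := B * l / q with hx
  have hx0 : 0 < x := by positivity
  set A : ℕ := 28 + 12 * p + ⌈x⌉₊ with hA
  have hxA : 1 + x ≤ A := by
    have := Nat.le_ceil x
    have hp0 : (0 : ℝ) ≤ p := by positivity
    rw [hA]
    push_cast
    linarith
  have hAle : (A : ℝ) ≤ (29 + 12 * (cq + 5)) * l + x := by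
    have := (Nat.ceil_lt_add_one hx0.le).le
    rw [hA]
    push_cast
    nlinarith
  have hbl : l * l * (cB * cw) ≤ B * w := by
    calc l * l * (cB * cw) = (cB * l) * (cw * l) := by ring
      _ ≤ B * w := mul_le_mul hB hw (by positivity) hBpos.le
  -- a block of `A` nodes occupies a constant number of disk blocks
  have hfit : (A : ℝ) * (q + 3) ≤ cA * (B * w) := by
    have h1 : (29 + 12 * (cq + 5)) * l * (q + 3)
        ≤ (29 + 12 * (cq + 5)) * (cq + 3) / (cB * cw) * (B * w) := by
      calc (29 + 12 * (cq + 5)) * l * (q + 3)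
          ≤ (29 + 12 * (cq + 5)) * l * ((cq + 3) * l) :=
            mul_le_mul_of_nonneg_left (by nlinarith) (by positivity)
        _ = (29 + 12 * (cq + 5)) * (cq + 3) / (cB * cw) * (l * l * (cB * cw)) := by
            field_simp
        _ ≤ _ := mul_le_mul_of_nonneg_left hbl (by positivity)
    have h2 : x * (q + 3) ≤ 4 / cw * (B * w) := by
      calc x * (q + 3) ≤ x * (4 * q) := mul_le_mul_of_nonneg_left (by linarith) hx0.le
        _ = 4 / cw * (B * (cw * l)) := by rw [hx]; field_simp
        _ ≤ _ := mul_le_mul_of_nonneg_left (mul_le_mul_of_nonneg_left hw hBpos.le) (by positivity)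
    calc (A : ℝ) * (q + 3) ≤ ((29 + 12 * (cq + 5)) * l + x) * (q + 3) :=
          mul_le_mul_of_nonneg_right hAle (by positivity)
      _ ≤ cA * (B * w) := by rw [hcA, add_mul, add_mul]; linarith
  have hfitR : 160 * (A * (q + 3)) + B * w ≤ R * (B * w) := by
    have h1 : (160 * (A * (q + 3)) + B * w : ℝ) ≤ R * (B * w) := by
      have h2 := Nat.le_ceil (160 * cA)
      have h3 : 160 * cA * (B * w) ≤ ⌈160 * cA⌉₊ * ((B : ℝ) * w) :=
        mul_le_mul_of_nonneg_right h2 (by positivity)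
      rw [hR]
      push_cast
      nlinarith
    exact_mod_cast h1
  have hq1' := hadm.one_le_key
  obtain ⟨code, decode, hcode⟩ := State.exists_code (q := q) (X := R * (B * w))
    (m := (5 * R + 2) * B * w) (by
      rw [mul_assoc (5 * R + 2), add_mul (5 * R) 2, mul_assoc 5 R]
      omega)
  let M : Machine q (B * w) ((5 * R + 2) * B * w) :=
    { d₀ := Nat.log 2 A
      A := A
      p := p
      R := R
      code := code
      decode := decode
      d₀_pos := Nat.log_pos (by norm_num) (by omega)
      pow_le := Nat.pow_log_le_self 2 (by omega)
      le_A := by omega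
      b_pos := hb
      pointer_fits := by
        have : A * 1 ≤ A * (q + 3) := Nat.mul_le_mul_left _ (by omega)
        omega
      block_fits := by
        have : 80 * A * (q + 7) ≤ 80 * A * (2 * (q + 3)) := Nat.mul_le_mul_left _ (by omega)
        rw [show 80 * A * (2 * (q + 3)) = 160 * (A * (q + 3)) by ring] at this
        omega
      decode_code := hcode }
  have hlen : (q + 3) * N < 2 ^ p := Nat.lt_size_self _
  have henc : ∀ T : BinaryTree (BitVec q), ∃ E : List Bool, T.numNodes = N →
      E.length ≤ (q + 3) * N ∧ ∀ nav : Navigator q, ∃ t,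
        M.program.Run E nav M.program.init [] t (nav.path T) ∧
          t ≤ R + 2 * R * crossings M.d₀ A nav [] M.d₀ A T := by
    intro T
    by_cases hT : T.numNodes = N
    · have hnil : T ≠ .nil := by
        rintro rfl
        simp at hT
        omega
      obtain ⟨E, h1, h2⟩ := M.exists_encoding hnil (by rw [hT]; exact hlen)
      exact ⟨E, fun _ => ⟨hT ▸ h1, h2⟩⟩
    · exact ⟨[], fun h => absurd h hT⟩
  choose enc henc using henc
  exact ⟨⟨enc, M.program⟩, A, M.d₀, M.d₀_pos, Nat.lt_pow_succ_log_self (by norm_num) A, hxA,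
    fun T hT => henc T hT⟩

end Parameters

/-! ### The number of block boundaries on a path -/

section Bounds

variable {q d₀ A N K : ℕ} {x : ℝ} {T : BinaryTree (BitVec q)} {nav : Navigator q}

theorem crossings_le_of_depth (hd₀ : 0 < d₀) (hA : A < 2 ^ (d₀ + 1)) (hx : 0 < x)
    (hxA : 1 + x ≤ A) (hK : (nav.path T).length = K + 1) :
    (crossings d₀ A nav [] d₀ A T : ℝ) ≤ 1 + 2 * (K / lg (1 + x)) := by
  have h1 := crossings_mul_le (A := A) hd₀ nav T [] d₀ A le_rfl
  have h2 : crossings d₀ A nav [] d₀ A T * d₀ ≤ K + 1 := by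
    rw [← hK]
    exact Nat.le_of_add_le_add_right h1
  have h3 : (crossings d₀ A nav [] d₀ A T : ℝ) * d₀ ≤ K + 1 := by exact_mod_cast h2
  have hd : (1 : ℝ) ≤ d₀ := by exact_mod_cast hd₀
  have h4 : lg (1 + x) ≤ 2 * d₀ := by
    have h5 : (1 + x) ≤ (2 : ℝ) ^ (d₀ + 1) := hxA.trans (by exact_mod_cast hA.le)
    have := lg_le_lg (by linarith) h5
    rw [lg_pow_two] at this
    push_cast at this
    linarith
  have h5 : 0 < lg (1 + x) := Real.logb_pos (by norm_num) (by linarith)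
  have h6 : (K : ℝ) / d₀ ≤ 2 * (K / lg (1 + x)) := by
    rw [← mul_div_assoc, div_le_div_iff₀ (by linarith) h5]
    nlinarith [(by positivity : (0 : ℝ) ≤ K)]
  have h7 : (crossings d₀ A nav [] d₀ A T : ℝ) ≤ (K + 1) / d₀ := by
    rwa [le_div_iff₀ (by linarith)]
  have h8 : (1 : ℝ) / d₀ ≤ 1 := by
    rw [div_le_one (by linarith)]
    exact hd
  rw [add_div] at h7
  linarith

/-- The bound from the shrinking of subtrees, for the path from the root. -/
theorem crossings_mul_log_le_lg (hd₀ : 0 < d₀) (hA : 0 < A) (hN : 2 ≤ N) (hT : T.numNodes = N)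
    (hK : (nav.path T).length = K + 1) (hK1 : 1 ≤ K) {D : ℝ} (hD : 0 < D) :
    (crossings d₀ A nav [] d₀ A T : ℝ) * (Real.log (A / (2 * D)) + 1) ≤ lg N + 2 * K / D := by
  have hNR : (2 : ℝ) ≤ N := by exact_mod_cast hN
  have h1 := crossings_mul_log_le hd₀ hA nav hD T [] d₀ A N 0 (by omega) (by omega)
    (by rw [hT, mul_div_assoc, div_self (by positivity)]; simp)
  have h2 : (nav.pathFrom [] T).length = K + 1 := hK
  rw [h2] at h1
  have h3 : Real.log N ≤ lg N := by
    rw [lg, Real.logb, le_div_iff₀ (Real.log_pos (by norm_num))]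
    have h4 : 0 ≤ Real.log (N : ℝ) := Real.log_nonneg (by linarith)
    have h5 : Real.log 2 ≤ 1 := by linarith [Real.log_two_lt_d9]
    nlinarith
  have h4 : (((0 : ℕ) : ℝ) + (K + 1 : ℕ)) / D ≤ 2 * K / D := by
    have : (1 : ℝ) ≤ K := by exact_mod_cast hK1
    push_cast
    gcongr
    linarith
  linarith

theorem crossings_le_of_medium (hd₀ : 0 < d₀) (hA : 0 < A) (hN : 2 ≤ N) (hT : T.numNodes = N)
    (hK : (nav.path T).length = K + 1) (hK1 : 1 ≤ K) (hx : 0 < x) (hxA : x ≤ A) {a' : ℝ}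
    (ha' : 0 < a') (hKle : (K : ℝ) ≤ a' * (x * lg N)) :
    (crossings d₀ A nav [] d₀ A T : ℝ)
      ≤ 2 * (5 + 4 * a') * (lg N / lg (1 + x * lg N / K)) := by
  have hl := one_le_lg hN
  have hKR : (1 : ℝ) ≤ K := by exact_mod_cast hK1
  set y : ℝ := x * lg N / K with hy
  have hy0 : 0 < y := by positivity
  have hy1 : 1 ≤ a' * y := by
    rw [hy, ← mul_div_assoc, le_div_iff₀ (by linarith)]
    linarith
  -- the tangent point is a small multiple of the average number of steps per block
  set D : ℝ := K / (2 * (1 + a') * lg N) with hD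
  have hD0 : 0 < D := by positivity
  have h1 := crossings_mul_log_le_lg hd₀ hA hN hT hK hK1 hD0
  have h2 : 2 * K / D = 4 * (1 + a') * lg N := by
    rw [hD]
    field_simp
    ring
  have h3 : 1 + y ≤ A / (2 * D) := by
    have h4 : (1 + a') * y ≤ A / (2 * D) := by
      have : A / (2 * D) = (1 + a') * (A * lg N / K) := by
        rw [hD]
        field_simp
      rw [this, hy]
      gcongr
    linarith
  have h4 : Real.log (1 + y) ≤ Real.log (A / (2 * D)) := Real.log_le_log (by linarith) h3
  have h5 : 0 < Real.log (1 + y) := Real.log_pos (by linarith)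
  have hc : (0 : ℝ) ≤ crossings d₀ A nav [] d₀ A T := by positivity
  have h6 : (crossings d₀ A nav [] d₀ A T : ℝ) * Real.log (1 + y) ≤ (5 + 4 * a') * lg N := by
    have : (crossings d₀ A nav [] d₀ A T : ℝ) * Real.log (1 + y)
        ≤ crossings d₀ A nav [] d₀ A T * (Real.log (A / (2 * D)) + 1) :=
      mul_le_mul_of_nonneg_left (by linarith) hc
    rw [h2] at h1
    linarith
  have h7 : 0 < lg (1 + y) := Real.logb_pos (by norm_num) (by linarith)
  have h8 : lg (1 + y) ≤ 2 * Real.log (1 + y) := by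
    rw [lg, Real.logb, div_le_iff₀ (Real.log_pos (by norm_num))]
    nlinarith [Real.log_two_gt_d9]
  rw [← mul_div_assoc, le_div_iff₀ h7]
  nlinarith

theorem crossings_le_of_long (hd₀ : 0 < d₀) (hA : 0 < A) (hN : 2 ≤ N) (hT : T.numNodes = N)
    (hK : (nav.path T).length = K + 1) (hK1 : 1 ≤ K) (hx : 0 < x) (hxA : x ≤ A) :
    (crossings d₀ A nav [] d₀ A T : ℝ) ≤ lg N + 4 * (K / x) := by
  have hAR : (0 : ℝ) < A := by exact_mod_cast hA
  -- at the tangent point `A / 2` the logarithm vanishes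
  have h1 := crossings_mul_log_le_lg hd₀ hA hN hT hK hK1 (half_pos hAR)
  rw [mul_div_cancel₀ _ (by norm_num : (2 : ℝ) ≠ 0), div_self hAR.ne', Real.log_one] at h1
  have h2 : 2 * (K : ℝ) / (A / 2) = 4 * (K / A) := by
    field_simp
    ring
  have h3 : (K : ℝ) / A ≤ K / x := by gcongr
  linarith

/-- A constant is of the order allowed for paths of medium length. -/
theorem lg_one_add_le (hN : 2 ≤ N) {a : ℝ} (ha : 0 < a) (hxN : x ≤ N * lg N) (hx : 0 < x)
    (hK : a * lg N ≤ K) : lg (1 + x * lg N / K) ≤ (lg (1 + 1 / a) + 2) * lg N := by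
  have hl := one_le_lg hN
  have hNR : (2 : ℝ) ≤ N := by exact_mod_cast hN
  have hK0 : (0 : ℝ) < K := lt_of_lt_of_le (by positivity) hK
  have h1 : x * lg N / K ≤ 1 / a * (N : ℝ) ^ 2 := by
    have h2 : x ≤ (N : ℝ) ^ 2 := by nlinarith [lg_le_self hN]
    calc x * lg N / K ≤ x * lg N / (a * lg N) := by gcongr
      _ = 1 / a * x := by field_simp
      _ ≤ _ := by gcongr
  have h2 : 1 + x * lg N / K ≤ (1 + 1 / a) * (N : ℝ) ^ 2 := by nlinarith
  have h3 : lg ((1 + 1 / a) * (N : ℝ) ^ 2) = lg (1 + 1 / a) + 2 * lg N := by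
    rw [lg, Real.logb_mul (by positivity) (by positivity), Real.logb_pow]
    rfl
  have h4 := lg_le_lg (by positivity) h2
  have h5 : 0 < lg (1 + 1 / a) :=
    Real.logb_pos (by norm_num) (by linarith [(by positivity : (0 : ℝ) < 1 / a)])
  rw [h3] at h4
  nlinarith

end Bounds

end PathBlocking

/-- The constants hidden in the assumptions are arbitrary but fixed.  The internal memory has
`μ * B` words.  The storage scheme `S` is the same for all path lengths. -/
theorem mainTheorem2 (cq cw cw' cB : ℝ) (hcq : 0 < cq) (hcw : 0 < cw) (hcw' : 0 < cw')
    (hcB : 0 < cB) :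
    ∃ (μ : ℕ) (f : ℕ → ℝ) (S : ∀ _N q B w : ℕ, TreeStorage q (B * w) (μ * B * w)),
      -- the space bound
      f =o[atTop] (fun N : ℕ => (N : ℝ)) ∧
      (∀ N q B w : ℕ, Admissible cq cw cw' cB N q B w →
        ∀ T : BinaryTree (BitVec q), T.numNodes = N →
          (((S N q B w).encode T).length : ℝ) ≤ (3 + (q : ℝ)) * N + f N) ∧
      -- `K = O(lg N)`
      (∀ a : ℝ, 0 < a → ∃ C : ℝ, 0 < C ∧
        ∀ N q B w : ℕ, Admissible cq cw cw' cB N q B w →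
        ∀ T : BinaryTree (BitVec q), T.numNodes = N →
        ∀ (nav : Navigator q) (K : ℕ), (nav.path T).length = K + 1 →
          (K : ℝ) ≤ a * lg N →
          ∃ t : ℕ, (S N q B w).ReportsPath T nav t ∧
            (t : ℝ) ≤ C * (1 + K / lg (1 + B * lg N / q))) ∧
      -- `K = Ω(lg N)` and `K = O(B lg² N / q)`
      (∀ a a' : ℝ, 0 < a → 0 < a' → ∃ C : ℝ, 0 < C ∧
        ∀ N q B w : ℕ, Admissible cq cw cw' cB N q B w →
        ∀ T : BinaryTree (BitVec q), T.numNodes = N →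
        ∀ (nav : Navigator q) (K : ℕ), (nav.path T).length = K + 1 →
          a * lg N ≤ (K : ℝ) → (K : ℝ) ≤ a' * (B * lg N ^ 2 / q) →
          ∃ t : ℕ, (S N q B w).ReportsPath T nav t ∧
            (t : ℝ) ≤ C * (lg N / lg (1 + B * lg N ^ 2 / (q * K)))) ∧
      -- `K = Ω(B lg² N / q)`
      (∀ a : ℝ, 0 < a → ∃ C : ℝ, 0 < C ∧
        ∀ N q B w : ℕ, Admissible cq cw cw' cB N q B w →
        ∀ T : BinaryTree (BitVec q), T.numNodes = N →
        ∀ (nav : Navigator q) (K : ℕ), (nav.path T).length = K + 1 →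
          a * (B * lg N ^ 2 / q) ≤ (K : ℝ) →
          ∃ t : ℕ, (S N q B w).ReportsPath T nav t ∧
            (t : ℝ) ≤ C * (q * K / (B * lg N))) := by
  -- outside the admissible range nothing is claimed, and any storage scheme will do
  obtain ⟨μ, R, hS⟩ := PathBlocking.exists_storage (cw' := cw') hcq hcw hcB
  have hS' : ∀ N q B w : ℕ, ∃ S : TreeStorage q (B * w) (μ * B * w),
      Admissible cq cw cw' cB N q B w → ∃ A d₀ : ℕ, 0 < d₀ ∧ A < 2 ^ (d₀ + 1) ∧
        1 + B * lg N / q ≤ A ∧ ∀ T : BinaryTree (BitVec q), T.numNodes = N →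
          (S.encode T).length ≤ (q + 3) * N ∧ ∀ nav : Navigator q, ∃ t : ℕ,
            S.ReportsPath T nav t ∧
              t ≤ R + 2 * R * PathBlocking.crossings d₀ A nav [] d₀ A T := by
    intro N q B w
    by_cases h : Admissible cq cw cw' cB N q B w
    · obtain ⟨S, h1⟩ := hS N q B w h
      exact ⟨S, fun _ => h1⟩
    · exact ⟨⟨fun _ => [], ⟨fun _ => false, fun _ => .halt⟩⟩, fun h' => absurd h' h⟩
  choose S hS using hS'
  refine ⟨μ, fun _ => 0, S, isLittleO_zero _ _, ?_, ?_, ?_, ?_⟩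
  · intro N q B w hadm T hT
    obtain ⟨A, d₀, -, -, -, h⟩ := hS N q B w hadm
    have h1 : (((S N q B w).encode T).length : ℝ) ≤ ((q + 3) * N : ℕ) := by
      exact_mod_cast (h T hT).1
    push_cast at h1
    linarith
  · intro a _
    refine ⟨4 * R + 1, by positivity, fun N q B w hadm T hT nav K hK _ => ?_⟩
    obtain ⟨A, d₀, hd₀, hA, hxA, h⟩ := hS N q B w hadm
    obtain ⟨hx, hN, hl⟩ := PathBlocking.params_pos hcB hadm
    obtain ⟨t, hrun, ht⟩ := (h T hT).2 nav
    refine ⟨t, hrun, ?_⟩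
    have h1 := PathBlocking.crossings_le_of_depth hd₀ hA hx hxA hK
    have h2 : (t : ℝ) ≤ R + 2 * R * PathBlocking.crossings d₀ A nav [] d₀ A T := by
      exact_mod_cast ht
    have h3 : 0 < lg (1 + B * lg N / q) := Real.logb_pos (by norm_num) (by linarith)
    have h4 : 0 ≤ (K : ℝ) / lg (1 + B * lg N / q) := by positivity
    have hR : (0 : ℝ) ≤ R := by positivity
    nlinarith [mul_le_mul_of_nonneg_left h1 hR]
  · intro a a' ha ha'
    have hR : (0 : ℝ) ≤ R := by positivity
    have hC1 : 0 < lg (1 + 1 / a) :=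
      Real.logb_pos (by norm_num) (by linarith [(by positivity : (0 : ℝ) < 1 / a)])
    refine ⟨R * (lg (1 + 1 / a) + 2) + 2 * R * (2 * (5 + 4 * a')) + 1, by positivity,
      fun N q B w hadm T hT nav K hK hKa hKa' => ?_⟩
    obtain ⟨A, d₀, hd₀, hA, hxA, h⟩ := hS N q B w hadm
    obtain ⟨hx, hN, hl⟩ := PathBlocking.params_pos hcB hadm
    obtain ⟨t, hrun, ht⟩ := (h T hT).2 nav
    refine ⟨t, hrun, ?_⟩
    have hK1 : 1 ≤ K := by
      have : (0 : ℝ) < K := lt_of_lt_of_le (by positivity) hKa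
      exact_mod_cast this
    have hK0 : (0 : ℝ) < K := by exact_mod_cast hK1
    have hA0 : 0 < A := by
      have : (0 : ℝ) < A := by linarith
      exact_mod_cast this
    have h1 := PathBlocking.crossings_le_of_medium hd₀ hA0 hN hT hK hK1 hx (by linarith) ha'
      (hKa'.trans_eq (by ring))
    have h2 : (t : ℝ) ≤ R + 2 * R * PathBlocking.crossings d₀ A nav [] d₀ A T := by
      exact_mod_cast ht
    have hq1 : (1 : ℝ) ≤ q := by exact_mod_cast hadm.one_le_key
    have hxN : B * lg N / q ≤ N * lg N := by
      have hBN : (B : ℝ) ≤ N := by exact_mod_cast hadm.block_le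
      rw [div_le_iff₀ (by linarith)]
      calc B * lg N ≤ N * lg N := by gcongr
        _ = N * lg N * 1 := (mul_one _).symm
        _ ≤ N * lg N * q := by gcongr
    have h3 := PathBlocking.lg_one_add_le hN ha hxN hx hKa
    have hy : B * lg N ^ 2 / (q * K) = B * lg N / q * lg N / K := by
      field_simp
    rw [hy]
    have h4 : 0 < lg (1 + B * lg N / q * lg N / K) :=
      Real.logb_pos (by norm_num)
        (by linarith [(by positivity : (0 : ℝ) < B * lg N / q * lg N / K)])
    set E := lg N / lg (1 + B * lg N / q * lg N / K) with hE
    have hE0 : 0 ≤ E := by positivity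
    have h5 : 1 ≤ (lg (1 + 1 / a) + 2) * E := by
      rw [hE, ← mul_div_assoc, le_div_iff₀ h4]
      linarith
    nlinarith [mul_le_mul_of_nonneg_left h1 hR, mul_le_mul_of_nonneg_left h5 hR]
  · intro a ha
    have hR : (0 : ℝ) ≤ R := by positivity
    refine ⟨R * (1 / a) + 2 * R * (1 / a + 4) + 1, by positivity,
      fun N q B w hadm T hT nav K hK hKa => ?_⟩
    obtain ⟨A, d₀, hd₀, hA, hxA, h⟩ := hS N q B w hadm
    obtain ⟨hx, hN, hl⟩ := PathBlocking.params_pos hcB hadm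
    obtain ⟨t, hrun, ht⟩ := (h T hT).2 nav
    refine ⟨t, hrun, ?_⟩
    have hKx : a * (B * lg N / q * lg N) ≤ K := le_trans (le_of_eq (by ring)) hKa
    have hK1 : 1 ≤ K := by
      have : (0 : ℝ) < K := lt_of_lt_of_le (by positivity) hKx
      exact_mod_cast this
    have hA0 : 0 < A := by
      have : (0 : ℝ) < A := by linarith
      exact_mod_cast this
    have h1 := PathBlocking.crossings_le_of_long hd₀ hA0 hN hT hK hK1 hx (by linarith)
    have h2 : (t : ℝ) ≤ R + 2 * R * PathBlocking.crossings d₀ A nav [] d₀ A T := by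
      exact_mod_cast ht
    have hq1 : (1 : ℝ) ≤ q := by exact_mod_cast hadm.one_le_key
    have hE : q * K / (B * lg N) = K / (B * lg N / q) := by
      field_simp
    rw [hE]
    set E := (K : ℝ) / (B * lg N / q) with hEdef
    have h3 : lg N ≤ 1 / a * E := by
      rw [hEdef, ← mul_div_assoc, le_div_iff₀ hx]
      calc lg N * (B * lg N / q) = 1 / a * (a * (B * lg N / q * lg N)) := by
            field_simp
        _ ≤ _ := mul_le_mul_of_nonneg_left hKx (by positivity)
    have hE0 : 0 ≤ E := by positivity
    have h4 : (PathBlocking.crossings d₀ A nav [] d₀ A T : ℝ) ≤ (1 / a + 4) * E := by linarith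
    nlinarith [mul_le_mul_of_nonneg_left h4 hR, mul_le_mul_of_nonneg_left (hl.trans h3) hR]
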